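/- For complex numbers $x,q$ put $(x;q)_0=1$ and $(x;q)_n=\prod_{k=0}^{n-1}(1-xq^k)$ for $n\ge 1$, and write $$\left[\begin{matrix}a,\,b,\,\dots,\,c\\ \alpha,\,\beta,\,\dots,\,\gamma\end{matrix}\,\Big|\,q\right]_n=\frac{(a;q)_n(b;q)_n\cdots(c;q)_n}{(\alpha;q)_n(\beta;q)_n\cdots(\gamma;q)_n},$$ $${}_{4}\phi_3\left[\begin{matrix}a_0,\,a_1,\,a_2,\,a_3\\ b_1,\,b_2,\,b_3\end{matrix}\,\Big|\,q;z\right]=\sum_{k=0}^{\infty}\left[\begin{matrix}a_0,\,a_1,\,a_2,\,a_3\\ q,\,b_1,\,b_2,\,b_3\end{matrix}\,\Big|\,q\right]_k z^k ,$$ where a series with an upper parameter $q^{-n}$ terminates, i.e. it is the sum over $0\le k\le n$. Let $\ell,m,n$ be nonnegative integers with $m\le n$, and let $q,a,c$ be nonzero complex numbers such that none of the denominators in the formula below vanishes. Then $${}_{4}\phi_3\left[\begin{matrix}a,\;c,\;q^{-n},\;-q^{1+\ell-m+n}a/c\\ q^{1+\ell}a/c,\;q^{1-m+n}a,\;-q^{-n}c\end{matrix}\,\Big|\,q;q\right]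 =\left[\begin{matrix}a,\;-q^{-\ell}c\\ q^{-\ell-1}c^2,\;-qa/c\end{matrix}\,\Big|\,q\right]_{\ell}\left[\begin{matrix}q^{1-m+n},\;-qa/c\\ q^{1-m+n}a,\;-q/c\end{matrix}\,\Big|\,q\right]_{n}$$ $$\times\sum_{i=0}^{\ell}\sum_{j=0}^{m}(-1)^{i}q^{(m-n)j+\binom{j+1}{2}}\Big(\frac{c}{a}\Big)^{i}\,\frac{1-q^{1+2i}/c^2}{1-q/c^2}\left[\begin{matrix}q^{-\ell},\;q^{1+\ell}a/c^2,\;q/c^2\\ q,\;q^{1-\ell}/a,\;q^{2+\ell}/c^2\end{matrix}\,\Big|\,q\right]_{i}$$ $$\times\left[\begin{matrix}q^{-m},\;q^{-n},\;-q^{-n},\;q^{\ell-i}a,\;q^{1+\ell+i}a/c^2\\ q,\;q^{1+\ell}a/c,\;-q^{1+\ell}a/c,\;q^{m-2n},\;q^{j-2n-1}\end{matrix}\,\Big|\,q\right]_{j}\left[\begin{matrix}q^{1+\ell-i+j}a,\;q^{2+\ell+i+j}a/c^2\\ q,\;q^{2+2\ell+2j}a^2/c^2\end{matrix}\,\Big|\,q^2\right]_{n-j}.$$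 -/

import Mathlib

/-- The `q`-shifted factorial `(x; q)_n = ∏_{k=0}^{n-1} (1 - x q^k)`, with `(x; q)_0 = 1`. -/
noncomputable def qPoch (x q : ℂ) (n : ℕ) : ℂ :=
  ∏ k ∈ Finset.range n, (1 - x * q ^ k)

/-- The fraction form `(a; q)_n (b; q)_n ⋯ (c; q)_n / ((α; q)_n (β; q)_n ⋯ (γ; q)_n)` of the
`q`-shifted factorial, for the list `num = [a, b, …, c]` of upper entries and the list
`den = [α, β, …, γ]` of lower entries. -/
noncomputable def qFrac (q : ℂ) (num den : List ℂ) (n : ℕ) : ℂ :=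
  (num.map fun x => qPoch x q n).prod / (den.map fun x => qPoch x q n).prod

/-- The summand of index `k` of the basic hypergeometric series with base `q`, argument `z`, upper
parameters `as = [a₀, …, a_r]` and lower parameters `bs = [b₁, …, b_s]`; the factor `(q; q)_k`
belongs to the denominator. -/
noncomputable def qHypTerm (q z : ℂ) (as bs : List ℂ) (k : ℕ) : ℂ :=
  qFrac q as (q :: bs) k * z ^ k

/-- The basic hypergeometric series `_{1+r}φ_s` with base `q`, argument `z`, upper parameters
`as = [a₀, …, a_r]` and lower parameters `bs = [b₁, …, b_s]`. -/
noncomputable def qHyp (q z : ℂ) (as bs : List ℂ) : ℂ :=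
  ∑' k : ℕ, qHypTerm q z as bs k

/-!
The left-hand side is a terminating balanced `₄φ₃`. Sears' transformation (`sears_transformation`),
which keeps the parameters `a` and `q ^ (1 + l) a / c`, turns it into a product times
`₄φ₃[q⁻ⁿ, -q ^ (m - n), a, q ^ (1 + l) a / c²; q ^ (1 + l) a / c, -q a / c, q ^ (m - 2 n); q, q]`.
For `l = m = 0` this is the series of Andrews' `q`-Watson sum (`qWatson_sum`), and the two integers
`l` and `m` are removed by expanding the summand.

* The parameters `a, q ^ (1 + l) a / c²; -q a / c` are expanded over `0 ≤ i ≤ l` in the parameters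
  `q ^ (l - i) a, q ^ (1 + l + i) a / c²; -q ^ (1 + l) a / c` (`qPoch_div_expansion_outer`). For
  each `i` the new parameters `A, B; E, -E` satisfy `E² = q A B`, as the `q`-Watson sum requires.
* The parameters `-q ^ (m - n); q ^ (m - 2 n)` are expanded over `0 ≤ j ≤ m` in
  `-q⁻ⁿ; q ^ (-2 n)` with the index shifted by `j` (`qPoch_div_expansion`). The inner sum is then a
  `q`-Watson sum of length `n - j` (`qWatson_sum_extended`).

Both expansions are instances of one very-well-poised sum (`wellPoised_sum`). This sum, the
`q`-Saalschütz sum behind Sears' transformation, and the `q`-Watson sum are proved by induction on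
the length, from a telescoping relation between consecutive lengths.

The intermediate series have denominators that may vanish when `q` is a root of unity although those
of the theorem do not. The argument is therefore carried out for `q` that is not a root of unity, and
the general case follows by continuity in `q`.
-/

/-! ### `q`-shifted factorials: splitting and reversal -/

theorem qPoch_zero (x q : ℂ) : qPoch x q 0 = 1 := by simp [qPoch]

theorem qPoch_succ (x q : ℂ) (n : ℕ) :
    qPoch x q (n + 1) = qPoch x q n * (1 - x * q ^ n) := by
  simp [qPoch, Finset.prod_range_succ]

theorem qPoch_add (x q : ℂ) (m n : ℕ) :
    qPoch x q (m + n) = qPoch x q m * qPoch (x * q ^ m) q n := by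
  simp [qPoch, Finset.prod_range_add, pow_add, mul_assoc]

theorem qPoch_succ' (x q : ℂ) (n : ℕ) :
    qPoch x q (n + 1) = (1 - x) * qPoch (x * q) q n := by
  rw [add_comm, qPoch_add]; simp [qPoch]

theorem qPoch_ne_zero_iff {x q : ℂ} {n : ℕ} :
    qPoch x q n ≠ 0 ↔ ∀ k < n, x * q ^ k ≠ 1 := by
  simp only [qPoch, Finset.prod_ne_zero_iff, Finset.mem_range, sub_ne_zero]
  exact forall₂_congr fun _ _ => ne_comm

theorem qPoch_ne_zero_of_le {x q : ℂ} {m n : ℕ} (h : qPoch x q n ≠ 0) (hmn : m ≤ n) :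
    qPoch x q m ≠ 0 :=
  qPoch_ne_zero_iff.2 fun k hk => qPoch_ne_zero_iff.1 h k (hk.trans_le hmn)

theorem qPoch_shift_ne_zero {x q : ℂ} {i m n : ℕ} (h : qPoch x q n ≠ 0) (hmn : i + m ≤ n) :
    qPoch (x * q ^ i) q m ≠ 0 := by
  have := qPoch_ne_zero_of_le h hmn
  rw [qPoch_add] at this
  exact right_ne_zero_of_mul this

/-- Reversal of the factors: if `x y q ^ n = q`, the factors of `(x; q)_n` are, up to monomials and
in the opposite order, those of `(y; q)_n`. -/
theorem qPoch_reflect {q : ℂ} (n : ℕ) :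
    ∀ {x y : ℂ}, q ≠ 0 → x * y * q ^ n = q →
      qPoch x q n = (-x) ^ n * q ^ (n.choose 2) * qPoch y q n := by
  induction n with
  | zero => intro x y _ _; simp [qPoch]
  | succ n ih =>
    intro x y hq h
    have h1 : x * q * y * q ^ n = q := by linear_combination h
    have h2 : x * y * q ^ n = 1 := by
      have : q * (x * y * q ^ n) = q * 1 := by linear_combination h
      exact mul_left_cancel₀ hq this
    rw [qPoch_succ', ih hq h1, qPoch_succ y, Nat.choose_succ_succ' n 1, Nat.choose_one_right]
    have : 1 - x = -x * (1 - y * q ^ n) := by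
      linear_combination -h2
    rw [this]
    ring

/-- Reversal for the last `j` of `j + r` factors. -/
theorem qPoch_reflect_tail {q x y : ℂ} (j r : ℕ) (hq : q ≠ 0) (h : x * y * q ^ (j + r) = q) :
    qPoch x q (j + r) =
      qPoch x q r * ((-x) ^ j * q ^ (r * j) * q ^ (j.choose 2) * qPoch y q j) := by
  rw [add_comm j r, qPoch_add, qPoch_reflect j (y := y) hq (by linear_combination h)]
  ring

/-! ### Summation by telescoping in the length -/

/-- The summation step behind the three closed forms below: the telescoping relation
`f' j = ρ f j + h j - h (j - 1)` for `j ≤ N`, completed by `f' (N + 1) = - h N`,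
gives `∑ f' = ρ ∑ f`. -/
theorem sum_eq_mul_sum_of_telescope (N : ℕ) (f f' h : ℕ → ℂ) (ρ : ℂ)
    (h0 : f' 0 = ρ * f 0 + h 0)
    (hs : ∀ j < N, f' (j + 1) = ρ * f (j + 1) + h (j + 1) - h j)
    (hN : f' (N + 1) = -h N) :
    ∑ j ∈ Finset.range (N + 2), f' j = ρ * ∑ j ∈ Finset.range (N + 1), f j := by
  have key : ∀ K ≤ N, ∑ j ∈ Finset.range (K + 1), f' j =
      ρ * ∑ j ∈ Finset.range (K + 1), f j + h K := by
    intro K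
    induction K with
    | zero => intro _; simpa using h0
    | succ K ih =>
      intro hK
      rw [Finset.sum_range_succ, ih (by omega), Finset.sum_range_succ _ (K + 1), hs K (by omega)]
      ring
  rw [Finset.sum_range_succ, key N le_rfl, hN]
  ring

/-! ### The `q`-Saalschütz sum -/

/-- The `q`-Pfaff–Saalschütz summation in a form free of negative powers of `q`. With `d = x y g`,
`b = y g` and `c = x g` it expands `(b; q)_N (c; q)_N / (d; q)_N`. -/
theorem saalschutz_sum {q x y g : ℂ} (hq : q ≠ 0) (N : ℕ) (hqN : qPoch q q N ≠ 0)
    (hd : qPoch (x * y * g) q N ≠ 0) :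
    ∑ j ∈ Finset.range (N + 1), qPoch q q N / (qPoch q q j * qPoch q q (N - j)) *
        (qPoch x q j * qPoch y q j / qPoch (x * y * g) q j) * (qPoch g q (N - j) * g ^ j) =
      qPoch (x * g) q N * qPoch (y * g) q N / qPoch (x * y * g) q N := by
  induction N with
  | zero => simp [qPoch]
  | succ N ih =>
    have hqN' := hqN
    have hd' := hd
    rw [qPoch_succ] at hqN' hd'
    have hq1 := left_ne_zero_of_mul hqN'
    have hq2 := right_ne_zero_of_mul hqN'
    have hd1 := left_ne_zero_of_mul hd'
    have hd2 := right_ne_zero_of_mul hd'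
    -- the second function below is the `q`-Zeilberger certificate of the recurrence in `N`
    rw [sum_eq_mul_sum_of_telescope N
      (fun j => qPoch q q N / (qPoch q q j * qPoch q q (N - j)) *
        (qPoch x q j * qPoch y q j / qPoch (x * y * g) q j) * (qPoch g q (N - j) * g ^ j)) _
      (fun j => -(q * q ^ N) / (1 - x * y * g * q ^ N) *
        (qPoch q q N / (qPoch q q j * qPoch q q (N - j)) *
        (qPoch x q j * qPoch y q j / qPoch (x * y * g) q j) * (qPoch g q (N - j) * g ^ j)) *
        (g / (q * q ^ j) * (1 - x * q ^ j) * (1 - y * q ^ j)))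
      ((1 - x * g * q ^ N) * (1 - y * g * q ^ N) / (1 - x * y * g * q ^ N)), ih hq1 hd1]
    · rw [qPoch_succ (x * g), qPoch_succ (y * g), qPoch_succ (x * y * g)]
      field_simp
    · simp only [Nat.sub_zero, qPoch_zero, pow_zero, qPoch_succ]
      clear ih hqN hd hqN' hd'
      generalize hD1 : 1 - x * y * g * q ^ N = D1 at *
      field_simp
      rw [← hD1]
      ring
    · intro j hj
      obtain ⟨r, rfl⟩ : ∃ r, N = j + 1 + r := ⟨N - (j + 1), by omega⟩
      have e1 : j + 1 + r + 1 - (j + 1) = r + 1 := by omega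
      have e2 : j + 1 + r - (j + 1) = r := by omega
      have e3 : j + 1 + r - j = r + 1 := by omega
      have a1 := qPoch_ne_zero_of_le hqN (show j + 1 ≤ j + 1 + r + 1 by omega)
      have a2 := qPoch_ne_zero_of_le hqN (show r + 1 ≤ j + 1 + r + 1 by omega)
      have a3 := qPoch_ne_zero_of_le hd (show j + 1 ≤ j + 1 + r + 1 by omega)
      simp only [e1, e2, e3, qPoch_succ _ _ r, qPoch_succ _ _ j, qPoch_succ _ _ (j + 1 + r)]
      rw [qPoch_succ] at a1 a2 a3
      have b1 := left_ne_zero_of_mul a1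
      have b2 := right_ne_zero_of_mul a1
      have b3 := left_ne_zero_of_mul a2
      have b4 := right_ne_zero_of_mul a2
      have b5 := left_ne_zero_of_mul a3
      have b6 := right_ne_zero_of_mul a3
      clear ih hqN hd hqN' hd' a1 a2 a3
      simp only [pow_add, pow_one] at *
      generalize qPoch q q (j + 1 + r) = Q0 at *
      generalize qPoch q q j = Q1 at *
      generalize qPoch q q r = Q2 at *
      generalize qPoch (x * y * g) q j = Q3 at *
      generalize qPoch x q j = Q4 at *
      generalize qPoch y q j = Q5 at *
      generalize qPoch g q r = Q6 at *
      have hz : q ^ j ≠ 0 := pow_ne_zero _ hq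
      have hz' : q ^ r ≠ 0 := pow_ne_zero _ hq
      generalize q ^ j = z at *
      generalize q ^ r = s at *
      generalize hD1 : 1 - x * y * g * (z * q * s) = D1 at *
      generalize hD2 : 1 - q * (z * q * s) = D2 at *
      generalize hD3 : 1 - q * z = D3 at *
      generalize hD4 : 1 - q * s = D4 at *
      generalize hD5 : 1 - x * y * g * z = D5 at *
      field_simp
      rw [← hD1, ← hD2, ← hD3, ← hD4, ← hD5]
      ring
    · have a1 : q ^ N ≠ 0 := pow_ne_zero _ hq
      simp only [Nat.sub_self, qPoch_zero, qPoch_succ, pow_succ]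
      field_simp

/-! ### A very-well-poised sum -/

/-- The terminating very-well-poised `₆φ₅` sum with base parameter `α = δ² q`, in the case that one
of the other parameters is a square root `δ q` of `α q`, so that it cancels against its partner.
It is normalized so as to hold for all `Y`, with no division by a factorial that involves `Y`. -/
theorem wellPoised_sum {q δ Y : ℂ} (N : ℕ) (hqN : qPoch q q N ≠ 0)
    (hα : qPoch (δ ^ 2 * q) q (2 * N + 1) ≠ 0) :
    ∑ i ∈ Finset.range (N + 1), qPoch q q N / (qPoch q q i * qPoch q q (N - i)) *
        ((1 - δ ^ 2 * q * q ^ (2 * i)) * qPoch (δ ^ 2 * q) q i /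
          qPoch (δ ^ 2 * q) q (N + i + 1)) *
        (qPoch (δ ^ 2 * q * q ^ N * Y) q i * qPoch Y q (N - i) * (δ * q) ^ (N - i)) =
      qPoch (Y * (δ * q)) q N / qPoch (δ * q) q N := by
  induction N with
  | zero =>
    have : (1 : ℂ) - δ ^ 2 * q ≠ 0 := by simpa [qPoch] using hα
    simp [qPoch, this]
  | succ N ih =>
    have hα1 := qPoch_ne_zero_of_le hα (show 2 * N + 1 ≤ 2 * (N + 1) + 1 by omega)
    have hα2 : (1 : ℂ) - δ ^ 2 * q * q ^ (2 * N + 1) ≠ 0 := by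
      have := qPoch_ne_zero_of_le hα (show 2 * N + 1 + 1 ≤ 2 * (N + 1) + 1 by omega)
      rw [qPoch_succ] at this
      exact right_ne_zero_of_mul this
    -- `1 - α q ^ (2 N + 1)` is a difference of two squares
    have hd : 1 - δ * q * q ^ N ≠ 0 := fun h => hα2 (by
      linear_combination (1 + δ * q * q ^ N) * h)
    have hqN' := hqN
    rw [qPoch_succ] at hqN'
    have hq1 := left_ne_zero_of_mul hqN'
    have hq2 := right_ne_zero_of_mul hqN'
    -- the certificate contains `(α q ^ (N + 1) Y; q)_i`, which avoids a division by
    -- `1 - α q ^ N Y`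
    rw [sum_eq_mul_sum_of_telescope N
      (fun i => qPoch q q N / (qPoch q q i * qPoch q q (N - i)) *
        ((1 - δ ^ 2 * q * q ^ (2 * i)) * qPoch (δ ^ 2 * q) q i /
          qPoch (δ ^ 2 * q) q (N + i + 1)) *
        (qPoch (δ ^ 2 * q * q ^ N * Y) q i * qPoch Y q (N - i) * (δ * q) ^ (N - i))) _
      (fun i => -(1 - (δ * q) ^ 2 * (q ^ N) ^ 2 * Y) / (1 - δ * q * q ^ N) *
        (qPoch q q N / (qPoch q q i * qPoch q q (N - i)) *
        (qPoch (δ ^ 2 * q) q (i + 1) / qPoch (δ ^ 2 * q) q (N + i + 2)) *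
        (qPoch (δ ^ 2 * q * q ^ N * Y * q) q i * qPoch Y q (N - i) * (δ * q) ^ (N - i))) *
        (1 - δ * q * q ^ i))
      ((1 - Y * (δ * q) * q ^ N) / (1 - δ * q * q ^ N)), ih hq1 hα1]
    · rw [qPoch_succ (Y * (δ * q)), qPoch_succ (δ * q)]
      rw [mul_div_mul_comm, mul_comm]
    · have a3 := qPoch_ne_zero_of_le hα (show N + 1 + 1 ≤ 2 * (N + 1) + 1 by omega)
      simp only [Nat.sub_zero, qPoch_zero, pow_zero, qPoch_succ, mul_zero, Nat.add_zero] at a3 ⊢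
      have b0 := left_ne_zero_of_mul (left_ne_zero_of_mul a3)
      have b1 := right_ne_zero_of_mul (left_ne_zero_of_mul a3)
      have b2 := right_ne_zero_of_mul a3
      have b3 : 1 - δ ^ 2 * q ≠ 0 := by
        have := qPoch_ne_zero_of_le hα (show 1 ≤ 2 * (N + 1) + 1 by omega)
        simpa [qPoch] using this
      clear ih hqN hα hqN' hα1 hα2 a3
      simp only [pow_succ q N] at *
      generalize hD1 : 1 - δ * q * q ^ N = D1 at *
      generalize hD2 : 1 - q * q ^ N = D2 at *
      generalize hD3 : 1 - δ ^ 2 * q * (q ^ N * q) = D3 at *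
      generalize hD4 : 1 - δ ^ 2 * q * q ^ N = D4 at *
      generalize hD5 : qPoch (δ ^ 2 * q) q N = D5 at *
      field_simp
      rw [← hD1, ← hD3]
      ring
    · intro i hi
      obtain ⟨r, rfl⟩ : ∃ r, N = i + 1 + r := ⟨N - (i + 1), by omega⟩
      have e1 : i + 1 + r + 1 - (i + 1) = r + 1 := by omega
      have e2 : i + 1 + r - (i + 1) = r := by omega
      have e3 : i + 1 + r - i = r + 1 := by omega
      have e4 : i + 1 + r + 1 + (i + 1) + 1 = i + 1 + r + i + 2 + 1 := by omega
      have e5 : i + 1 + r + (i + 1) + 1 = i + 1 + r + i + 2 := by omega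
      have e6 : i + 1 + r + (i + 1) + 2 = i + 1 + r + i + 2 + 1 := by omega
      have e7 : δ ^ 2 * q * q ^ (i + 1 + r + 1) * Y = δ ^ 2 * q * q ^ (i + 1 + r) * Y * q := by ring
      have a1 := qPoch_ne_zero_of_le hqN (show i + 1 ≤ i + 1 + r + 1 by omega)
      have a2 := qPoch_ne_zero_of_le hqN (show r + 1 ≤ i + 1 + r + 1 by omega)
      have a3 := qPoch_ne_zero_of_le hα
        (show i + 1 + r + i + 2 + 1 ≤ 2 * (i + 1 + r + 1) + 1 by omega)
      simp only [e1, e2, e3, e4, e5, e6, e7]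
      rw [qPoch_succ' (δ ^ 2 * q * q ^ (i + 1 + r) * Y)]
      simp only [qPoch_succ _ _ r, qPoch_succ _ _ i, qPoch_succ _ _ (i + 1),
        qPoch_succ _ _ (i + 1 + r), qPoch_succ _ _ (i + 1 + r + i + 2)]
      rw [qPoch_succ] at a1 a2 a3
      have b1 := left_ne_zero_of_mul a1
      have b2 := right_ne_zero_of_mul a1
      have b3 := left_ne_zero_of_mul a2
      have b4 := right_ne_zero_of_mul a2
      have b5 := left_ne_zero_of_mul a3
      have b6 := right_ne_zero_of_mul a3
      clear ih hqN hα hqN' hα1 hα2 a1 a2 a3 e4 e5 e6 e7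
      have f1 : q ^ (i + 1 + r + i + 2) = (q ^ i) ^ 2 * q ^ r * q ^ 3 := by ring
      have f2 : q ^ (2 * (i + 1)) = (q ^ i) ^ 2 * q ^ 2 := by ring
      have f3 : q ^ (i + 1 + r) = q ^ i * q ^ r * q := by ring
      simp only [f1, f2, f3, pow_succ q i] at *
      generalize qPoch q q (i + 1 + r) = Q0 at *
      generalize qPoch q q i = Q1 at *
      generalize qPoch q q r = Q2 at *
      generalize qPoch (δ ^ 2 * q) q i = Q3 at *
      generalize qPoch (δ ^ 2 * q) q (i + 1 + r + i + 2) = Q4 at *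
      generalize qPoch (δ ^ 2 * q * (q ^ i * q ^ r * q) * Y * q) q i = Q5 at *
      generalize qPoch Y q r = Q6 at *
      generalize q ^ i = z at *
      generalize q ^ r = s at *
      generalize hD1 : 1 - δ * q * (z * s * q) = D1 at *
      generalize hD2 : 1 - q * (z * s * q) = D2 at *
      generalize hD3 : 1 - q * z = D3 at *
      generalize hD4 : 1 - q * s = D4 at *
      generalize hD5 : 1 - δ ^ 2 * q * (z ^ 2 * s * q ^ 3) = D5 at *
      rw [pow_succ (δ * q) r]
      generalize (δ * q) ^ r = P at *
      field_simp
      rw [← hD1, ← hD2, ← hD3, ← hD4, ← hD5]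
      ring
    · have a3 := qPoch_ne_zero_of_le hα (show N + N + 2 + 1 ≤ 2 * (N + 1) + 1 by omega)
      have e4 : N + 1 + (N + 1) + 1 = N + N + 2 + 1 := by omega
      have e7 : δ ^ 2 * q * q ^ (N + 1) * Y = δ ^ 2 * q * q ^ N * Y * q := by ring
      simp only [Nat.sub_self, qPoch_zero, pow_zero, e4, e7]
      simp only [qPoch_succ _ _ N, qPoch_succ _ _ (N + N + 2)]
      rw [qPoch_succ] at a3
      have b5 := left_ne_zero_of_mul a3
      have b6 := right_ne_zero_of_mul a3
      clear ih hqN hα hqN' hα1 hα2 a3 e4 e7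
      have f1 : q ^ (N + N + 2) = (q ^ N) ^ 2 * q ^ 2 := by ring
      have f2 : q ^ (2 * (N + 1)) = (q ^ N) ^ 2 * q ^ 2 := by ring
      simp only [f1, f2] at *
      generalize q ^ N = z at *
      generalize hD1 : 1 - δ * q * z = D1 at *
      generalize hD2 : 1 - q * z = D2 at *
      generalize hD5 : 1 - δ ^ 2 * q * (z ^ 2 * q ^ 2) = D5 at *
      field_simp

/-! ### Andrews' `q`-Watson sum -/

/-- Andrews' terminating `q`-analogue of Watson's summation, a balanced `₄φ₃` with upper
parameters `A, B, q ^ (-N), -q ^ (-N)` and lower parameters `√(q A B), -√(q A B), q ^ (-2 N)`; the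
factorials in base `q ^ 2` are the products over the two signs. -/
theorem qWatson_sum {q A B : ℂ} (hq : q ≠ 0) (hq1 : ∀ k : ℕ, q ^ (k + 1) ≠ 1) (N : ℕ)
    (hAB : qPoch (q * A * B) (q ^ 2) N ≠ 0) :
    ∑ k ∈ Finset.range (N + 1),
        qPoch (q ^ (2 * N))⁻¹ (q ^ 2) k * qPoch A q k * qPoch B q k /
          (qPoch q q k * qPoch (q ^ (2 * N))⁻¹ q k * qPoch (q * A * B) (q ^ 2) k) * q ^ k =
      qPoch (q * A) (q ^ 2) N * qPoch (q * B) (q ^ 2) N /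
        (qPoch q (q ^ 2) N * qPoch (q * A * B) (q ^ 2) N) := by
  induction N with
  | zero => simp [qPoch]
  | succ N ih =>
    have hAB' := hAB
    rw [qPoch_succ] at hAB'
    have hAB1 := left_ne_zero_of_mul hAB'
    have hAB2 := right_ne_zero_of_mul hAB'
    have hqk (k : ℕ) : 1 - q * q ^ k ≠ 0 := by
      rw [← pow_succ']; exact sub_ne_zero.2 (hq1 k).symm
    have hqq (k : ℕ) : qPoch q q k ≠ 0 := by
      rw [qPoch_ne_zero_iff]; intro i _; rw [← pow_succ']; exact hq1 i
    have hpow (k : ℕ) : q ^ k ≠ 0 := pow_ne_zero _ hq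
    obtain ⟨u, hu⟩ : ∃ u : ℂ, u = (q ^ (2 * (N + 1)))⁻¹ := ⟨_, rfl⟩
    have hu1 : u * q ^ 2 * (q ^ N) ^ 2 = 1 := by
      rw [hu]; have := hpow N; field_simp; ring
    have hw : (q ^ (2 * N))⁻¹ = u * q ^ 2 := by
      rw [hu]; have := hpow N; field_simp; ring
    have huk (k : ℕ) (hk : k < 2 * N + 2) : 1 - u * q ^ k ≠ 0 := by
      intro h
      obtain ⟨r, hr⟩ : ∃ r, 2 * N + 2 = k + r + 1 := ⟨2 * N + 1 - k, by omega⟩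
      apply hq1 r
      have : u * q ^ (k + r + 1) = 1 := by rw [← hr, ← hu1]; ring
      linear_combination this + q ^ (r + 1) * h
    have hu1q : 1 - u * q ≠ 0 := by simpa using huk 1 (by omega)
    have hu1' : 1 - u ≠ 0 := by simpa using huk 0 (by omega)
    -- the lower parameter `w = q ^ (-2 N)` causes no zero up to the index `N`
    have hwk (k : ℕ) (hk : k ≤ N) : qPoch (u * q ^ 2) q k ≠ 0 := by
      rw [qPoch_ne_zero_iff]; intro i hi h
      exact huk (i + 2) (by omega) (by linear_combination -h)
    have hq2N : 1 - q * q ^ (2 * N) ≠ 0 := hqk _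
    rw [hw] at ih
    rw [← hu, sum_eq_mul_sum_of_telescope N
      (fun k => qPoch (u * q ^ 2) (q ^ 2) k * qPoch A q k * qPoch B q k /
          (qPoch q q k * qPoch (u * q ^ 2) q k * qPoch (q * A * B) (q ^ 2) k) * q ^ k) _
      (fun k => qPoch (u * q ^ 2) (q ^ 2) k * qPoch A q k * qPoch B q k /
          (qPoch q q k * qPoch (u * q ^ 2) q k * qPoch (q * A * B) (q ^ 2) k) *
          ((1 - A * q ^ k) * (1 - B * q ^ k) /
            ((1 - q * A * B * (q ^ 2) ^ N) * (1 - u * q))))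
      ((1 - q * A * (q ^ 2) ^ N) * (1 - q * B * (q ^ 2) ^ N) /
        ((1 - q * (q ^ 2) ^ N) * (1 - q * A * B * (q ^ 2) ^ N))), ih hAB1]
    · simp only [qPoch_succ]
      rw [div_mul_div_comm]
      congr 1 <;> ring
    · simp only [qPoch_zero, pow_zero]
      have hz := hpow N
      have hu2 : u = (q ^ 2 * (q ^ N) ^ 2)⁻¹ := by rw [hu]; congr 1; ring
      rw [pow_mul'] at hq2N
      rw [← pow_mul, pow_mul'] at hAB2 ⊢
      clear ih hAB hAB' hAB1 hwk huk hpow hqk hqq hw hu hq1 hu1 hu1'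
      generalize q ^ N = z at *
      generalize hD1 : 1 - q * z ^ 2 = D1 at *
      generalize hD2 : 1 - q * A * B * z ^ 2 = D2 at *
      generalize hD3 : 1 - u * q = D3 at *
      field_simp
      rw [← hD1, ← hD2, ← hD3, hu2]
      field_simp
      ring
    · -- `u = q ^ (-2 (N + 1))` is replaced by its value only after denominators are cleared
      intro k hk
      obtain ⟨r, rfl⟩ : ∃ r, N = k + 1 + r := ⟨N - (k + 1), by omega⟩
      have hfu : qPoch u q (k + 1) = (1 - u) * (1 - u * q) * qPoch (u * q ^ 2) q k /
          (1 - u * q * q ^ k) := by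
        have h1 : 1 - u * q * q ^ k ≠ 0 := by
          have := huk (k + 1) (by omega)
          rwa [pow_succ', ← mul_assoc] at this
        rw [eq_div_iff h1, qPoch_succ', mul_assoc, ← qPoch_succ, qPoch_succ']
        ring_nf
      have a1 := qPoch_ne_zero_of_le hAB (show k + 1 ≤ k + 1 + r + 1 by omega)
      rw [qPoch_succ] at a1
      have b1 := left_ne_zero_of_mul a1
      have b2 := right_ne_zero_of_mul a1
      have b3 := hqk k
      have b4 := hqq k
      have b5 := hwk k (by omega)
      have b6 : 1 - u * q * q ^ k ≠ 0 := by
        have := huk (k + 1) (by omega)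
        rwa [pow_succ', ← mul_assoc] at this
      have b7 : 1 - u * q ^ 2 * q ^ k ≠ 0 := by
        have := huk (k + 2) (by omega)
        rwa [pow_add, mul_comm (q ^ k), ← mul_assoc] at this
      rw [hfu, qPoch_succ' u (q ^ 2)]
      simp only [qPoch_succ]
      have hz := hpow k
      have hs := hpow r
      have hu2 : u = (q ^ 4 * (q ^ k) ^ 2 * (q ^ r) ^ 2)⁻¹ := by rw [hu]; congr 1; ring
      have f1 : (q ^ 2) ^ (k + 1 + r) = (q ^ k) ^ 2 * (q ^ r) ^ 2 * q ^ 2 := by ring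
      have f2 : q ^ (2 * (k + 1 + r)) = (q ^ k) ^ 2 * (q ^ r) ^ 2 * q ^ 2 := by ring
      have f3 : (q ^ 2) ^ k = (q ^ k) ^ 2 := by ring
      rw [f2] at hq2N
      rw [f1] at hAB2
      rw [f3] at b2
      simp only [f1, f3, pow_succ q k]
      clear ih hAB hAB' hAB1 hwk huk hpow hqk hqq hw hu hq1 hu1 a1 hfu f1 f2 f3
      generalize qPoch q q k = Q1 at *
      generalize qPoch (u * q ^ 2) q k = Q2 at *
      generalize qPoch (u * q ^ 2) (q ^ 2) k = Q3 at *
      generalize qPoch (q * A * B) (q ^ 2) k = Q4 at *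
      generalize q ^ k = z at *
      generalize q ^ r = s at *
      generalize hD1 : 1 - q * z = D1 at *
      generalize hD2 : 1 - q * A * B * (z ^ 2 * s ^ 2 * q ^ 2) = D2 at *
      generalize hD3 : 1 - u * q = D3 at *
      generalize hD4 : 1 - u * q * z = D4 at *
      generalize hD5 : 1 - u * q ^ 2 * z = D5 at *
      generalize hD6 : 1 - q * A * B * z ^ 2 = D6 at *
      generalize hD7 : 1 - q * (z ^ 2 * s ^ 2 * q ^ 2) = D7 at *
      generalize hD8 : 1 - u = D8 at *
      field_simp
      rw [← hD1, ← hD2, ← hD3, ← hD4, ← hD5, ← hD6, ← hD7, hu2]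
      field_simp
      ring
    · have hfu : qPoch u q (N + 1) = (1 - u) * (1 - u * q) * qPoch (u * q ^ 2) q N /
          (1 - u * q * q ^ N) := by
        have h1 : 1 - u * q * q ^ N ≠ 0 := by
          have := huk (N + 1) (by omega)
          rwa [pow_succ', ← mul_assoc] at this
        rw [eq_div_iff h1, qPoch_succ', mul_assoc, ← qPoch_succ, qPoch_succ']
        ring_nf
      have b3 := hqk N
      have b4 := hqq N
      have b5 := hwk N le_rfl
      have b6 : 1 - u * q * q ^ N ≠ 0 := by
        have := huk (N + 1) (by omega)
        rwa [pow_succ', ← mul_assoc] at this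
      rw [hfu, qPoch_succ' u (q ^ 2)]
      simp only [qPoch_succ]
      have hz := hpow N
      have hu2 : u = (q ^ 2 * (q ^ N) ^ 2)⁻¹ := by rw [hu]; congr 1; ring
      have f1 : (q ^ 2) ^ N = (q ^ N) ^ 2 := by ring
      simp only [f1, pow_succ q N] at hAB2 ⊢
      clear ih hAB hAB' hwk huk hpow hqk hqq hw hu hq1 hu1 hfu
      generalize qPoch q q N = Q1 at *
      generalize qPoch (u * q ^ 2) q N = Q2 at *
      generalize qPoch (u * q ^ 2) (q ^ 2) N = Q3 at *
      generalize qPoch (q * A * B) (q ^ 2) N = Q4 at *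
      generalize q ^ N = z at *
      generalize hD1 : 1 - q * z = D1 at *
      generalize hD3 : 1 - u * q = D3 at *
      generalize hD4 : 1 - u * q * z = D4 at *
      generalize hD6 : 1 - q * A * B * z ^ 2 = D6 at *
      generalize hD8 : 1 - u = D8 at *
      field_simp
      rw [← hD1, ← hD4, hu2]
      field_simp
      ring

/-! ### Sears' transformation -/

/-- The `q`-Pfaff–Saalschütz summation in its usual form; here `w = q ^ (-N)`, and the lower
parameters are `x y g` and `f = q ^ (1 - N) / g`. -/
theorem saalschutz_sum_reflected {q x y g w f : ℂ} (hq : q ≠ 0) (N : ℕ) (hqN : qPoch q q N ≠ 0)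
    (hd : qPoch (x * y * g) q N ≠ 0) (hf : qPoch f q N ≠ 0) (hg0 : g ≠ 0)
    (hw : w * q ^ N = 1) (hg : g * f * q ^ N = q) :
    (∑ i ∈ Finset.range (N + 1), qPoch w q i * qPoch x q i * qPoch y q i /
        (qPoch q q i * qPoch (x * y * g) q i * qPoch f q i) * q ^ i) * qPoch g q N =
      qPoch (x * g) q N * qPoch (y * g) q N / qPoch (x * y * g) q N := by
  rw [← saalschutz_sum hq N hqN hd, Finset.sum_mul]
  refine Finset.sum_congr rfl fun i hi => ?_
  obtain ⟨r, rfl⟩ : ∃ r, N = i + r := ⟨N - i, by have := Finset.mem_range.1 hi; omega⟩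
  have e1 := qPoch_reflect_tail (x := q) (y := w) i r hq (by rw [mul_assoc, hw, mul_one])
  have e2 := qPoch_reflect_tail i r hq hg
  have h1 := qPoch_ne_zero_of_le hqN (show i ≤ i + r by omega)
  have h2 := qPoch_ne_zero_of_le hqN (show r ≤ i + r by omega)
  have h3 := qPoch_ne_zero_of_le hd (show i ≤ i + r by omega)
  have h4 := qPoch_ne_zero_of_le hf (show i ≤ i + r by omega)
  have e3 : (-g) ^ i = (-1) ^ i * g ^ i := neg_pow _ _
  have e4 : (-q) ^ i = (-1) ^ i * q ^ i := neg_pow _ _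
  rw [Nat.add_sub_cancel_left, e2, e1, e3, e4]
  field_simp

set_option maxHeartbeats 800000 in
/-- Sears' transformation of terminating balanced `₄φ₃` series; here `w = q ^ (-n)`. Both sides are
the two orders of summation of one double sum. Saalschütz's formula expands
`(b; q)_k (c; q)_k / (d; q)_k`, and then sums the other index. -/
theorem sears_transformation {q a b c d e f w : ℂ} (n : ℕ) (hq : q ≠ 0) (ha : a ≠ 0) (hb : b ≠ 0)
    (hc : c ≠ 0) (hd : d ≠ 0) (he : e ≠ 0) (hf : f ≠ 0) (hw : w * q ^ n = 1)
    (hbal : d * e * f = a * b * c * (q * w)) (hqn : qPoch q q n ≠ 0) (hdn : qPoch d q n ≠ 0)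
    (hen : qPoch e q n ≠ 0) (hfn : qPoch f q n ≠ 0) (hen' : qPoch (a * (q * w) / e) q n ≠ 0)
    (hfn' : qPoch (a * (q * w) / f) q n ≠ 0) :
    ∑ k ∈ Finset.range (n + 1), qPoch w q k * qPoch a q k * qPoch b q k * qPoch c q k /
        (qPoch q q k * qPoch d q k * qPoch e q k * qPoch f q k) * q ^ k =
      qPoch (e / a) q n * qPoch (f / a) q n * a ^ n / (qPoch e q n * qPoch f q n) *
        ∑ j ∈ Finset.range (n + 1),
          qPoch w q j * qPoch a q j * qPoch (d / b) q j * qPoch (d / c) q j /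
            (qPoch q q j * qPoch d q j * qPoch (a * (q * w) / e) q j *
              qPoch (a * (q * w) / f) q j) * q ^ j := by
  have hw0 : w ≠ 0 := left_ne_zero_of_mul (by rw [hw]; exact one_ne_zero)
  obtain ⟨T, hT⟩ : ∃ T : ℕ → ℕ → ℂ, T = fun j i =>
      qPoch w q (j + i) * qPoch a q (j + i) / (qPoch e q (j + i) * qPoch f q (j + i)) *
        q ^ (j + i) * (qPoch (d / b) q j * qPoch (d / c) q j * qPoch (b * c / d) q i *
          (b * c / d) ^ j / (qPoch q q j * qPoch q q i * qPoch d q j)) := ⟨_, rfl⟩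
  have step1 : ∀ k ∈ Finset.range (n + 1),
      qPoch w q k * qPoch a q k * qPoch b q k * qPoch c q k /
        (qPoch q q k * qPoch d q k * qPoch e q k * qPoch f q k) * q ^ k =
      ∑ j ∈ Finset.range (k + 1), T j (k - j) := by
    intro k hk
    have hkn : k ≤ n := by have := Finset.mem_range.1 hk; omega
    have hqk := qPoch_ne_zero_of_le hqn hkn
    have e1 : d / b * (d / c) * (b * c / d) = d := by field_simp
    have e2 : d / b * (b * c / d) = c := by field_simp
    have e3 : d / c * (b * c / d) = b := by field_simp
    have key := saalschutz_sum (x := d / b) (y := d / c) (g := b * c / d) hq k hqk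
      (by rw [e1]; exact qPoch_ne_zero_of_le hdn hkn)
    rw [e1, e2, e3] at key
    have : qPoch w q k * qPoch a q k * qPoch b q k * qPoch c q k /
        (qPoch q q k * qPoch d q k * qPoch e q k * qPoch f q k) * q ^ k =
        qPoch w q k * qPoch a q k / (qPoch e q k * qPoch f q k) * q ^ k / qPoch q q k *
        (qPoch c q k * qPoch b q k / qPoch d q k) := by ring
    rw [this, ← key, Finset.mul_sum]
    refine Finset.sum_congr rfl fun j hj => ?_
    have hjk : j + (k - j) = k := by have := Finset.mem_range.1 hj; omega
    simp only [hT, hjk]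
    field_simp
  rw [Finset.sum_congr rfl step1, Finset.sum_range_diag_flip (n + 1) T, Finset.mul_sum]
  refine Finset.sum_congr rfl fun j hj => ?_
  obtain ⟨N, rfl⟩ : ∃ N, n = j + N := ⟨n - j, by have := Finset.mem_range.1 hj; omega⟩
  have hN : j + N + 1 - j = N + 1 := by omega
  rw [hN]
  -- `g = q ^ (1 - n) / f` is the argument for the inner Saalschütz sum
  obtain ⟨g, hg⟩ : ∃ g, g = q * w / f := ⟨_, rfl⟩
  have hg0 : g ≠ 0 := by rw [hg]; positivity
  have hgf : g * f * q ^ (j + N) = q := by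
    rw [hg, div_mul_cancel₀ _ hf, mul_assoc, hw, mul_one]
  have hfg : f * g * q ^ (j + N) = q := by rw [mul_comm f, hgf]
  have hxyg : a * q ^ j * (b * c / d) * g = e * q ^ j := by
    rw [hg]; field_simp; linear_combination -hbal
  have hxg : a * q ^ j * g = a * (q * w) / f * q ^ j := by rw [hg]; ring
  have hyg : b * c / d * g = e / a := by
    rw [hg]; field_simp; linear_combination -hbal
  have inner := saalschutz_sum_reflected (x := a * q ^ j) (y := b * c / d) (g := g) (w := w * q ^ j)
    (f := f * q ^ j) hq N (qPoch_ne_zero_of_le hqn (by omega))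
    (by rw [hxyg]; exact qPoch_shift_ne_zero hen le_rfl) (qPoch_shift_ne_zero hfn le_rfl) hg0
    (by rw [← hw]; ring) (by linear_combination hgf)
  rw [hxyg, hxg, hyg] at inner
  have r1 := qPoch_reflect_tail (x := e / a) (y := a * (q * w) / e) j N hq (by
    field_simp; linear_combination hw)
  have r2 := qPoch_reflect_tail j N hq hgf
  have r3 := qPoch_reflect (j + N) hq hfg
  have r4 := qPoch_reflect (x := f / a) (y := a * (q * w) / f) (j + N) hq (by
    field_simp; linear_combination hw)
  have n1 : qPoch e q j ≠ 0 := qPoch_ne_zero_of_le hen (by omega)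
  have n2 : qPoch f q j ≠ 0 := qPoch_ne_zero_of_le hfn (by omega)
  have n3 : qPoch (a * (q * w) / e) q j ≠ 0 := qPoch_ne_zero_of_le hen' (by omega)
  have n4 : qPoch (a * (q * w) / f) q j ≠ 0 := qPoch_ne_zero_of_le hfn' (by omega)
  have n5 : qPoch (e * q ^ j) q N ≠ 0 := qPoch_shift_ne_zero hen le_rfl
  have n6 : qPoch g q (j + N) ≠ 0 := fun h => hfn (by rw [r3, h, mul_zero])
  have n7 : qPoch g q N ≠ 0 := qPoch_ne_zero_of_le n6 (by omega)
  have hF : qPoch (f / a) q (j + N) * a ^ (j + N) / qPoch f q (j + N) =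
      qPoch (a * (q * w) / f) q (j + N) / qPoch g q (j + N) := by
    rw [r3, r4, ← neg_div, div_pow]
    have : (-f) ^ (j + N) ≠ 0 := pow_ne_zero _ (neg_ne_zero.2 hf)
    field_simp
  have hsum : ∑ i ∈ Finset.range (N + 1), T j i =
      qPoch w q j * qPoch a q j / (qPoch e q j * qPoch f q j) * q ^ j *
        (qPoch (d / b) q j * qPoch (d / c) q j * (b * c / d) ^ j / (qPoch q q j * qPoch d q j)) *
      ∑ i ∈ Finset.range (N + 1), qPoch (w * q ^ j) q i * qPoch (a * q ^ j) q i *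
        qPoch (b * c / d) q i / (qPoch q q i * qPoch (e * q ^ j) q i * qPoch (f * q ^ j) q i) *
        q ^ i := by
    rw [Finset.mul_sum]
    refine Finset.sum_congr rfl fun i _ => ?_
    simp only [hT, qPoch_add _ _ j i, pow_add]
    ring
  rw [hsum, eq_div_of_mul_eq n7 inner]
  have : qPoch (e / a) q (j + N) * qPoch (f / a) q (j + N) * a ^ (j + N) /
      (qPoch e q (j + N) * qPoch f q (j + N)) = qPoch (e / a) q (j + N) / qPoch e q (j + N) *
      (qPoch (f / a) q (j + N) * a ^ (j + N) / qPoch f q (j + N)) := by ring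
  have hneg : -(e / a) = b * c / d * -g := by rw [← hyg]; ring
  rw [this, hF, r1, r2, qPoch_add e, qPoch_add (a * (q * w) / f), hneg, mul_pow]
  have hgj : (-g) ^ j ≠ 0 := pow_ne_zero _ (neg_ne_zero.2 hg0)
  generalize (-g) ^ j = G at *
  have hqj : qPoch q q j ≠ 0 := qPoch_ne_zero_of_le hqn (by omega)
  have hdj : qPoch d q j ≠ 0 := qPoch_ne_zero_of_le hdn (by omega)
  clear hsum this hF r1 r2 r3 r4 inner step1 hen' hfn' hfn hen hdn n6
  generalize (b * c / d) ^ j = G0 at *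
  generalize qPoch (a * (q * w) / e) q j = X1 at *
  generalize qPoch (a * (q * w) / f) q j = X2 at *
  generalize qPoch (a * (q * w) / f * q ^ j) q N = X3 at *
  generalize qPoch (e * q ^ j) q N = X4 at *
  generalize qPoch (e / a) q N = X5 at *
  generalize qPoch (d / b) q j = X6 at *
  generalize qPoch (d / c) q j = X7 at *
  field_simp

/-! ### The extended `q`-Watson sum -/

theorem qPoch_sq (x q : ℂ) (n : ℕ) :
    qPoch (x ^ 2) (q ^ 2) n = qPoch x q n * qPoch (-x) q n := by
  rw [qPoch, qPoch, qPoch, ← Finset.prod_mul_distrib]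
  refine Finset.prod_congr rfl fun k _ => ?_
  ring

theorem zpow_ne_one_of_pow_ne_one {q : ℂ} (hq1 : ∀ k : ℕ, q ^ (k + 1) ≠ 1) {z : ℤ} (hz : z ≠ 0) :
    q ^ z ≠ 1 := by
  obtain ⟨k, rfl | rfl⟩ := z.eq_nat_or_neg
  · obtain ⟨r, rfl⟩ : ∃ r, k = r + 1 := ⟨k - 1, by omega⟩
    exact_mod_cast hq1 r
  · obtain ⟨r, rfl⟩ : ∃ r, k = r + 1 := ⟨k - 1, by omega⟩
    rw [zpow_neg, inv_ne_one]
    exact_mod_cast hq1 r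

theorem qPoch_zpow_ne_zero {q : ℂ} (hq : q ≠ 0) (hq1 : ∀ k : ℕ, q ^ (k + 1) ≠ 1) {z : ℤ} {n : ℕ}
    (hz : ∀ i < n, z + (i : ℤ) ≠ 0) : qPoch (q ^ z) q n ≠ 0 := by
  rw [qPoch_ne_zero_iff]
  intro i hi
  rw [← zpow_natCast q i, ← zpow_add₀ hq]
  exact zpow_ne_one_of_pow_ne_one hq1 (hz i hi)

theorem qPoch_neg_zpow_ne_zero {q : ℂ} (hq : q ≠ 0) (hq1 : ∀ k : ℕ, q ^ (k + 1) ≠ 1) {z : ℤ}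
    {n : ℕ} (hz : ∀ i < n, z + (i : ℤ) ≠ 0) : qPoch (-q ^ z) q n ≠ 0 := by
  rw [qPoch_ne_zero_iff]
  intro i hi h
  have h2 : z + i + (z + i) ≠ 0 := by have := hz i hi; omega
  apply zpow_ne_one_of_pow_ne_one hq1 h2
  rw [zpow_add₀ hq, zpow_add₀ hq, zpow_natCast]
  linear_combination (-q ^ z * q ^ i + 1) * h

theorem qPoch_self_ne_zero {q : ℂ} (hq1 : ∀ k : ℕ, q ^ (k + 1) ≠ 1) (n : ℕ) :
    qPoch q q n ≠ 0 := by
  rw [qPoch_ne_zero_iff]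
  intro i _
  rw [← pow_succ']
  exact hq1 i

theorem choose_two_succ_add_choose_two (j : ℕ) : (j + 1).choose 2 + j.choose 2 = j * j := by
  induction j with
  | zero => rfl
  | succ j ih =>
    have h1 := Nat.choose_succ_succ' (j + 1) 1
    have h2 := Nat.choose_succ_succ' j 1
    simp only [Nat.choose_one_right] at h1 h2
    nlinarith

/-- The expansion of `(-q ^ (m - n); q)_k / (q ^ (m - 2 n); q)_k` in the corresponding quotients
for `m = 0`, with index shifted by `j`. This is `wellPoised_sum` with `α = q ^ (-2 n - 1)`, upper
parameter `q ^ (-m)`, and the square root `-q ^ (-n)` of `α q`. -/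
theorem qPoch_div_expansion {q : ℂ} (hq : q ≠ 0) (hq1 : ∀ k : ℕ, q ^ (k + 1) ≠ 1) {m n k : ℕ}
    (hmn : m ≤ n) (hkn : k ≤ n) :
    qPoch (-q ^ ((m : ℤ) - n)) q k / (qPoch q q k * qPoch (q ^ ((m : ℤ) - 2 * n)) q k) =
      ∑ j ∈ Finset.range (k + 1), q ^ (((m : ℤ) - n - 1) * j + ((j + 1).choose 2 : ℤ)) *
        (qPoch (q ^ (-(m : ℤ))) q j / (qPoch q q j * qPoch (q ^ ((m : ℤ) - 2 * n)) q j *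
          qPoch (q ^ ((j : ℤ) - 2 * n - 1)) q j)) *
        (qPoch (-q ^ (-(n : ℤ))) q k /
          (qPoch q q (k - j) * qPoch (q ^ (2 * (j : ℤ) - 2 * n)) q (k - j))) := by
  have e1 : (-q ^ (-(n : ℤ) - 1)) ^ 2 * q = q ^ (-2 * (n : ℤ) - 1) := by
    rw [neg_sq, ← zpow_natCast, ← zpow_mul, ← zpow_add_one₀ hq]
    congr 1; push_cast; ring
  have e2 : -q ^ (-(n : ℤ) - 1) * q = -q ^ (-(n : ℤ)) := by
    rw [neg_mul, ← zpow_add_one₀ hq]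
    congr 2; ring
  have e3 : q ^ (-2 * (n : ℤ) - 1) * q ^ k * q ^ (2 * (n : ℤ) + 1 - m - k) = q ^ (-(m : ℤ)) := by
    rw [← zpow_natCast q k, ← zpow_add₀ hq, ← zpow_add₀ hq]
    congr 1; ring
  have e4 : q ^ (2 * (n : ℤ) + 1 - m - k) * -q ^ (-(n : ℤ)) = -q ^ ((n : ℤ) + 1 - m - k) := by
    rw [mul_neg, ← zpow_add₀ hq]
    congr 2; ring
  have key := wellPoised_sum (q := q) (δ := -q ^ (-(n : ℤ) - 1))
    (Y := q ^ (2 * (n : ℤ) + 1 - m - k)) k (qPoch_self_ne_zero hq1 k) (by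
      rw [e1]; exact qPoch_zpow_ne_zero hq hq1 fun i hi => by omega)
  rw [e1, e2, e3, e4] at key
  have hY : q ^ (2 * (n : ℤ) + 1 - m - k) * q ^ ((m : ℤ) - 2 * n) * q ^ k = q := by
    rw [← zpow_natCast q k, ← zpow_add₀ hq, ← zpow_add₀ hq]
    conv_rhs => rw [← zpow_one q]
    congr 1; ring
  have hYd : -q ^ ((n : ℤ) + 1 - m - k) * -q ^ ((m : ℤ) - n) * q ^ k = q := by
    rw [neg_mul_neg, ← zpow_natCast q k, ← zpow_add₀ hq, ← zpow_add₀ hq]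
    conv_rhs => rw [← zpow_one q]
    congr 1; ring
  have n1 : qPoch (q ^ ((m : ℤ) - 2 * n)) q k ≠ 0 :=
    qPoch_zpow_ne_zero hq hq1 fun i hi => by omega
  have n2 : qPoch (-q ^ (-(n : ℤ))) q k ≠ 0 :=
    qPoch_neg_zpow_ne_zero hq hq1 fun i hi => by omega
  have r1 := qPoch_reflect k hq hY
  have r2 := qPoch_reflect k hq hYd
  rw [r2] at key
  obtain ⟨M, hM⟩ : ∃ M : ℂ, M = q ^ ((n : ℤ) + 1 - m - k) := ⟨_, rfl⟩
  have hM0 : M ≠ 0 := by rw [hM]; exact zpow_ne_zero _ hq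
  have hqC : q ^ (k.choose 2) ≠ 0 := pow_ne_zero _ hq
  have lhs : qPoch (-q ^ ((m : ℤ) - n)) q k / (qPoch q q k * qPoch (q ^ ((m : ℤ) - 2 * n)) q k) =
      (qPoch (-q ^ (-(n : ℤ))) q k / (M ^ k * q ^ (k.choose 2) * qPoch q q k *
        qPoch (q ^ ((m : ℤ) - 2 * n)) q k)) *
      ((- -q ^ ((n : ℤ) + 1 - m - k)) ^ k * q ^ (k.choose 2) * qPoch (-q ^ ((m : ℤ) - n)) q k /
        qPoch (-q ^ (-(n : ℤ))) q k) := by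
    rw [neg_neg, ← hM]
    have n3 := qPoch_self_ne_zero hq1 k
    generalize qPoch (q ^ ((m : ℤ) - 2 * n)) q k = X1 at *
    generalize qPoch (-q ^ (-(n : ℤ))) q k = X2 at *
    generalize qPoch (-q ^ ((m : ℤ) - n)) q k = X3 at *
    field_simp
  rw [lhs, ← key, Finset.mul_sum]
  refine Finset.sum_congr rfl fun j hj => ?_
  obtain ⟨r, rfl⟩ : ∃ r, k = j + r := ⟨k - j, by have := Finset.mem_range.1 hj; omega⟩
  rw [Nat.add_sub_cancel_left]
  have r3 := qPoch_reflect_tail j r hq hY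
  have hα : qPoch (q ^ (-2 * (n : ℤ) - 1)) q (j + r + j + 1) =
      qPoch (q ^ (-2 * (n : ℤ) - 1)) q j * qPoch (q ^ ((j : ℤ) - 2 * n - 1)) q j *
        (1 - q ^ (-2 * (n : ℤ) - 1) * q ^ (2 * j)) * qPoch (q ^ (2 * (j : ℤ) - 2 * n)) q r := by
    have s1 : j + r + j + 1 = j + j + 1 + r := by ring
    have s2 : q ^ (-2 * (n : ℤ) - 1) * q ^ j = q ^ ((j : ℤ) - 2 * n - 1) := by
      rw [← zpow_natCast q j, ← zpow_add₀ hq]; congr 1; ring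
    have s3 : q ^ (-2 * (n : ℤ) - 1) * q ^ (j + j + 1) = q ^ (2 * (j : ℤ) - 2 * n) := by
      rw [← zpow_natCast q (j + j + 1), ← zpow_add₀ hq]; congr 1; push_cast; ring
    rw [s1, qPoch_add, qPoch_succ, qPoch_add, s2, s3, two_mul j]
  have nα : qPoch (q ^ (-2 * (n : ℤ) - 1)) q (j + r + j + 1) ≠ 0 :=
    qPoch_zpow_ne_zero hq hq1 fun i hi => by omega
  have hexp : q ^ (((m : ℤ) - n - 1) * j + ((j + 1).choose 2 : ℤ)) *
      (M ^ j * q ^ (r * j) * q ^ (j.choose 2)) = 1 := by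
    have hc : (((j + 1).choose 2 : ℕ) : ℤ) + (j.choose 2 : ℕ) = j * j := by
      exact_mod_cast choose_two_succ_add_choose_two j
    rw [hM, ← zpow_natCast _ j, ← zpow_mul, ← zpow_natCast q (r * j),
      ← zpow_natCast q (j.choose 2), ← zpow_add₀ hq, ← zpow_add₀ hq, ← zpow_add₀ hq]
    rw [← zpow_zero q]
    congr 1
    push_cast
    linear_combination hc
  rw [hα] at nα ⊢
  have hYM : q ^ (2 * (n : ℤ) + 1 - m - (j + r : ℕ)) * q ^ (-(n : ℤ)) = M := by
    rw [hM, ← zpow_add₀ hq]; congr 1; ring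
  rw [r1] at r3
  rw [eq_inv_of_mul_eq_one_left hexp]
  have hY0 : q ^ (2 * (n : ℤ) + 1 - m - (j + r : ℕ)) ≠ 0 := zpow_ne_zero _ hq
  have m1 := qPoch_self_ne_zero hq1 j
  have m2 := qPoch_self_ne_zero hq1 r
  have m3 := qPoch_self_ne_zero hq1 (j + r)
  have m4 : qPoch (q ^ ((m : ℤ) - 2 * n)) q j ≠ 0 := qPoch_ne_zero_of_le n1 (by omega)
  have m5 := right_ne_zero_of_mul nα
  have m6 := right_ne_zero_of_mul (left_ne_zero_of_mul nα)
  have m7 := left_ne_zero_of_mul (left_ne_zero_of_mul (left_ne_zero_of_mul nα))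
  have m8 := right_ne_zero_of_mul (left_ne_zero_of_mul (left_ne_zero_of_mul nα))
  have hqr : q ^ (r * j) ≠ 0 := pow_ne_zero _ hq
  have hqj : q ^ (j.choose 2) ≠ 0 := pow_ne_zero _ hq
  have r4 : qPoch (q ^ (2 * (n : ℤ) + 1 - m - (j + r : ℕ))) q r =
      (-q ^ (2 * (n : ℤ) + 1 - m - (j + r : ℕ))) ^ r * q ^ ((j + r).choose 2) *
        qPoch (q ^ ((m : ℤ) - 2 * n)) q (j + r) /
        (q ^ (r * j) * q ^ (j.choose 2) * qPoch (q ^ ((m : ℤ) - 2 * n)) q j) := by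
    have hYj := pow_ne_zero j (neg_ne_zero.2 hY0)
    rw [eq_div_iff (by positivity)]
    refine mul_left_cancel₀ hYj ?_
    rw [pow_add] at r3
    linear_combination -r3
  have hYD : (-q ^ (2 * (n : ℤ) + 1 - m - (j + r : ℕ))) ^ r * (-q ^ (-(n : ℤ))) ^ r = M ^ r := by
    rw [← mul_pow, neg_mul_neg, hYM]
  have hMr := pow_ne_zero r hM0
  clear r1 r2 r3 key lhs hα nα hexp hY hYd e1 e2 e3 e4
  rw [r4]
  generalize qPoch (q ^ ((m : ℤ) - 2 * n)) q j = Z1 at *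
  generalize qPoch (q ^ ((m : ℤ) - 2 * n)) q (j + r) = Z2 at *
  generalize qPoch (-q ^ (-(n : ℤ))) q (j + r) = Z3 at *
  generalize qPoch (q ^ (-2 * (n : ℤ) - 1)) q j = Z4 at *
  generalize qPoch (q ^ ((j : ℤ) - 2 * n - 1)) q j = Z5 at *
  generalize qPoch (q ^ (2 * (j : ℤ) - 2 * n)) q r = Z6 at *
  generalize 1 - q ^ (-2 * (n : ℤ) - 1) * q ^ (2 * j) = Z7 at *
  generalize qPoch (q ^ (-(m : ℤ))) q j = Z8 at *
  generalize (-q ^ (2 * (n : ℤ) + 1 - m - (j + r : ℕ))) ^ r = W1 at *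
  generalize (-q ^ (-(n : ℤ))) ^ r = W2 at *
  rw [pow_add M, ← hYD]
  rw [← hYD] at hMr
  have hW1 := left_ne_zero_of_mul hMr
  have hW2 := right_ne_zero_of_mul hMr
  field_simp

/-- The extension of Andrews' `q`-Watson sum by a nonnegative integer `m`; `E ^ 2 = q A B`. After
`qPoch_div_expansion`, the sum over `k = j + i` is for each `j` a `q`-Watson sum of length
`n - j`. -/
theorem qWatson_sum_extended {q A B E : ℂ} (hq : q ≠ 0) (hq1 : ∀ k : ℕ, q ^ (k + 1) ≠ 1) {m n : ℕ}
    (hmn : m ≤ n) (hE : E ^ 2 = q * A * B) (hE1 : qPoch E q n ≠ 0) (hE2 : qPoch (-E) q n ≠ 0) :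
    ∑ k ∈ Finset.range (n + 1), qPoch (q ^ (-(n : ℤ))) q k * qPoch (-q ^ ((m : ℤ) - n)) q k *
        qPoch A q k * qPoch B q k /
        (qPoch q q k * qPoch E q k * qPoch (-E) q k * qPoch (q ^ ((m : ℤ) - 2 * n)) q k) * q ^ k =
      ∑ j ∈ Finset.range (m + 1), q ^ (((m : ℤ) - n) * j + ((j + 1).choose 2 : ℤ)) *
        (qPoch (q ^ (-(m : ℤ))) q j * qPoch (q ^ (-(n : ℤ))) q j * qPoch (-q ^ (-(n : ℤ))) q j *
          qPoch A q j * qPoch B q j /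
          (qPoch q q j * qPoch E q j * qPoch (-E) q j * qPoch (q ^ ((m : ℤ) - 2 * n)) q j *
            qPoch (q ^ ((j : ℤ) - 2 * n - 1)) q j)) *
        (qPoch (q * (A * q ^ j)) (q ^ 2) (n - j) * qPoch (q * (B * q ^ j)) (q ^ 2) (n - j) /
          (qPoch q (q ^ 2) (n - j) * qPoch ((E * q ^ j) ^ 2) (q ^ 2) (n - j))) := by
  obtain ⟨c, hc⟩ : ∃ c : ℕ → ℂ, c = fun (j : ℕ) =>
      q ^ (((m : ℤ) - n - 1) * j + ((j + 1).choose 2 : ℤ)) *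
        (qPoch (q ^ (-(m : ℤ))) q j / (qPoch q q j * qPoch (q ^ ((m : ℤ) - 2 * n)) q j *
          qPoch (q ^ ((j : ℤ) - 2 * n - 1)) q j)) := ⟨_, rfl⟩
  obtain ⟨T, hT⟩ : ∃ T : ℕ → ℕ → ℂ, T = fun (j i : ℕ) =>
      c j * (qPoch (q ^ (-(n : ℤ))) q (j + i) * qPoch (-q ^ (-(n : ℤ))) q (j + i) *
        qPoch A q (j + i) * qPoch B q (j + i) /
        (qPoch E q (j + i) * qPoch (-E) q (j + i) * qPoch q q i *
          qPoch (q ^ (2 * (j : ℤ) - 2 * n)) q i) * q ^ (j + i)) := ⟨_, rfl⟩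
  have step1 : ∀ k ∈ Finset.range (n + 1),
      qPoch (q ^ (-(n : ℤ))) q k * qPoch (-q ^ ((m : ℤ) - n)) q k * qPoch A q k * qPoch B q k /
        (qPoch q q k * qPoch E q k * qPoch (-E) q k * qPoch (q ^ ((m : ℤ) - 2 * n)) q k) * q ^ k =
      ∑ j ∈ Finset.range (k + 1), T j (k - j) := by
    intro k hk
    have key := qPoch_div_expansion hq hq1 hmn (show k ≤ n by have := Finset.mem_range.1 hk; omega)
    calc _ = qPoch (q ^ (-(n : ℤ))) q k * qPoch A q k * qPoch B q k /
          (qPoch E q k * qPoch (-E) q k) * q ^ k * (qPoch (-q ^ ((m : ℤ) - n)) q k /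
            (qPoch q q k * qPoch (q ^ ((m : ℤ) - 2 * n)) q k)) := by ring
      _ = _ := by
        rw [key, Finset.mul_sum]
        refine Finset.sum_congr rfl fun j hj => ?_
        have hjk : j + (k - j) = k := by have := Finset.mem_range.1 hj; omega
        simp only [hT, hc, hjk]
        ring
  rw [Finset.sum_congr rfl step1, Finset.sum_range_diag_flip (n + 1) T]
  -- `(q ^ (-m); q)_j` vanishes for `j > m`
  have hzero : ∀ j ∈ Finset.range (n + 1), j ∉ Finset.range (m + 1) →
      ∑ i ∈ Finset.range (n + 1 - j), T j i = 0 := by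
    intro j _ hj
    have hmj : m < j := by have := mt Finset.mem_range.2 hj; omega
    have : qPoch (q ^ (-(m : ℤ))) q j = 0 := by
      by_contra h
      refine qPoch_ne_zero_iff.1 h m hmj ?_
      rw [zpow_neg, zpow_natCast, inv_mul_cancel₀ (pow_ne_zero _ hq)]
    refine Finset.sum_eq_zero fun i _ => ?_
    simp only [hT, hc, this, zero_div, mul_zero, zero_mul]
  rw [← Finset.sum_subset (Finset.range_mono (by omega)) hzero]
  refine Finset.sum_congr rfl fun j hj => ?_
  obtain ⟨N, rfl⟩ : ∃ N, n = j + N := ⟨n - j, by have := Finset.mem_range.1 hj; omega⟩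
  have hN : j + N + 1 - j = N + 1 := by omega
  rw [hN, Nat.add_sub_cancel_left]
  have hEj : q * (A * q ^ j) * (B * q ^ j) = (E * q ^ j) ^ 2 := by
    rw [mul_pow, hE]; ring
  have hw : (q ^ (2 * N))⁻¹ = (q ^ (-(N : ℤ))) ^ 2 := by
    rw [← zpow_natCast, ← zpow_natCast, ← zpow_mul, ← zpow_neg]
    congr 1; push_cast; ring
  have hw' : (q ^ (2 * N))⁻¹ = q ^ (2 * (j : ℤ) - 2 * (j + N : ℕ)) := by
    rw [← zpow_natCast, ← zpow_neg]
    congr 1; push_cast; ring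
  have hw1 : q ^ (-((j + N : ℕ) : ℤ)) * q ^ j = q ^ (-(N : ℤ)) := by
    rw [← zpow_natCast q j, ← zpow_add₀ hq]; congr 1; push_cast; ring
  have key := qWatson_sum (A := A * q ^ j) (B := B * q ^ j) hq hq1 N (by
    rw [hEj, qPoch_sq, ← neg_mul]
    exact mul_ne_zero (qPoch_shift_ne_zero hE1 le_rfl) (qPoch_shift_ne_zero hE2 le_rfl))
  rw [hEj] at key
  rw [← key, Finset.mul_sum]
  refine Finset.sum_congr rfl fun i _ => ?_
  have hp : q ^ (((m : ℤ) - (j + N : ℕ)) * j + ((j + 1).choose 2 : ℤ)) =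
      q ^ (((m : ℤ) - (j + N : ℕ) - 1) * j + ((j + 1).choose 2 : ℤ)) * q ^ j := by
    rw [← zpow_natCast q j, ← zpow_add₀ hq]; congr 1; ring
  rw [hp, qPoch_sq, hw']
  nth_rw 1 [← hw']
  rw [hw, qPoch_sq, ← hw1]
  simp only [hT, hc, qPoch_add _ _ j i, pow_add, neg_mul]
  ring

/-! ### The expansion over `i` -/

/-- The coefficient of index `i` in the expansion over `0 ≤ i ≤ l`: the part of the right-hand
side that depends on `l` and `i` but on neither `m`, `n` nor `j`. -/
noncomputable def outerCoeff (q a c : ℂ) (l i : ℕ) : ℂ :=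
  qPoch a q l * qPoch (-q ^ (-(l : ℤ)) * c) q l /
    (qPoch (q ^ (-(l : ℤ) - 1) * c ^ 2) q l * qPoch (-q * a / c) q l) *
  ((-1) ^ i * (c / a) ^ i * ((1 - q ^ (1 + 2 * i) / c ^ 2) / (1 - q / c ^ 2)) *
    (qPoch (q ^ (-(l : ℤ))) q i * qPoch (q ^ (1 + l) * a / c ^ 2) q i * qPoch (q / c ^ 2) q i /
      (qPoch q q i * qPoch (q ^ (1 - (l : ℤ)) / a) q i * qPoch (q ^ (2 + l) / c ^ 2) q i)))

/-- The expansion of the quotient that contains `(-q a / c; q)_k` in such quotients with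
`-q ^ (1 + l) a / c` instead. As a function of `q ^ k` it writes one polynomial of degree `l` as a
combination of `l + 1` others, by `wellPoised_sum` with `Y = a q ^ k`. The coefficients do not depend
on `k`. -/
theorem qPoch_div_expansion_outer {q a c : ℂ} {l : ℕ} (k : ℕ) (hq : q ≠ 0) (ha : a ≠ 0)
    (hc : c ≠ 0)
    (hp1 : qPoch (q ^ (-(l : ℤ) - 1) * c ^ 2) q l ≠ 0)
    (hi0 : 1 - q / c ^ 2 ≠ 0)
    (hi1 : qPoch q q l ≠ 0)
    (hi2 : qPoch (q ^ (1 - (l : ℤ)) / a) q l ≠ 0)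
    (hi3 : qPoch (q ^ (2 + l) / c ^ 2) q l ≠ 0)
    (hD : qPoch (-q * a / c) q (l + k) ≠ 0) :
    qPoch a q k * qPoch (q ^ (1 + l) * a / c ^ 2) q k / qPoch (-q * a / c) q k =
      ∑ i ∈ Finset.range (l + 1), outerCoeff q a c l i *
        (qPoch (q ^ ((l : ℤ) - i) * a) q k * qPoch (q ^ (1 + l + i) * a / c ^ 2) q k /
          qPoch (-q ^ (1 + (l : ℤ)) * a / c) q k) := by
  have r3 : qPoch (-q ^ (-(l : ℤ)) * c) q l =
      (- (-q ^ (-(l : ℤ)) * c)) ^ l * q ^ (l.choose 2) * qPoch (-q / c) q l :=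
    qPoch_reflect l hq (by rw [zpow_neg, zpow_natCast]; field_simp)
  have r4 : qPoch (q ^ (-(l : ℤ) - 1) * c ^ 2) q l =
      (- (q ^ (-(l : ℤ) - 1) * c ^ 2)) ^ l * q ^ (l.choose 2) * qPoch (q / c ^ 2 * q) q l :=
    qPoch_reflect l hq (by rw [zpow_sub_one₀ hq, zpow_neg, zpow_natCast]; field_simp)
  have n1 : qPoch (q / c ^ 2 * q) q l ≠ 0 := fun h => hp1 (by rw [r4, h, mul_zero])
  have e3 : q / c ^ 2 * q ^ (l + 1) = q ^ (2 + l) / c ^ 2 := by ring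
  have hαi (i : ℕ) : qPoch (q / c ^ 2) q (l + i + 1) =
      (1 - q / c ^ 2) * qPoch (q / c ^ 2 * q) q l * qPoch (q ^ (2 + l) / c ^ 2) q i := by
    have : l + i + 1 = l + 1 + i := by ring
    rw [this, qPoch_add, qPoch_succ', e3]
  have hα : qPoch (q / c ^ 2) q (2 * l + 1) ≠ 0 := by
    rw [two_mul, hαi]
    exact mul_ne_zero (mul_ne_zero hi0 n1) hi3
  -- `-q / c` is a square root of `α q` for `α = q / c ^ 2`, so a zero of `(-q / c; q)_l` would be
  -- one of `(α; q)_(2 l + 1)`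
  have hdl : qPoch (-q / c) q l ≠ 0 := by
    rw [qPoch_ne_zero_iff] at hα ⊢
    intro i hi h
    refine hα (2 * i + 1) (by omega) ?_
    calc _ = (-q / c * q ^ i) ^ 2 := by ring
      _ = 1 := by rw [h, one_pow]
  have e1 : (-c⁻¹) ^ 2 * q = q / c ^ 2 := by ring
  have e2 : -c⁻¹ * q = -q / c := by ring
  have key := wellPoised_sum (q := q) (δ := -c⁻¹) (Y := a * q ^ k) l hi1 (by rwa [e1])
  rw [e1, e2] at key
  have e4 : a * q ^ k * (-q / c) = -q * a / c * q ^ k := by ring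
  have e5 : q / c ^ 2 * q ^ l * (a * q ^ k) = q ^ (1 + l) * a / c ^ 2 * q ^ k := by ring
  have e6 : -q ^ (1 + (l : ℤ)) * a / c = -q * a / c * q ^ l := by
    rw [zpow_add₀ hq, zpow_natCast, zpow_one]; ring
  rw [e4, e5] at key
  rw [e6]
  have hD' := hD
  rw [qPoch_add] at hD'
  have hD1 := left_ne_zero_of_mul hD'
  have hD2 := right_ne_zero_of_mul hD'
  have hDD : qPoch (-q * a / c) q k * qPoch (-q * a / c * q ^ k) q l =
      qPoch (-q * a / c) q l * qPoch (-q * a / c * q ^ l) q k := by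
    rw [← qPoch_add, ← qPoch_add, add_comm]
  have hDk := qPoch_ne_zero_of_le hD (show k ≤ l + k by omega)
  have lhs : qPoch a q k * qPoch (q ^ (1 + l) * a / c ^ 2) q k / qPoch (-q * a / c) q k =
      qPoch a q k * qPoch (q ^ (1 + l) * a / c ^ 2) q k * qPoch (-q / c) q l /
        (qPoch (-q * a / c) q l * qPoch (-q * a / c * q ^ l) q k) *
      (qPoch (-q * a / c * q ^ k) q l / qPoch (-q / c) q l) := by
    rw [← hDD]
    have : qPoch (-q * a / c * q ^ k) q l ≠ 0 := fun h => by
      rw [h, mul_zero] at hDD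
      exact mul_ne_zero hD1 hD2 hDD.symm
    generalize qPoch (-q * a / c * q ^ k) q l = X1 at *
    generalize qPoch (-q / c) q l = X2 at *
    generalize qPoch (-q * a / c) q k = X3 at *
    field_simp
  rw [lhs, ← key, Finset.mul_sum]
  refine Finset.sum_congr rfl fun i hi => ?_
  obtain ⟨r, rfl⟩ : ∃ r, l = i + r := ⟨l - i, by have := Finset.mem_range.1 hi; omega⟩
  have f1 : q ^ (((i + r : ℕ) : ℤ) - i) * a = a * q ^ r := by
    rw [Nat.cast_add, add_sub_cancel_left, zpow_natCast, mul_comm]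
  have f2 : q ^ (1 + (i + r) + i) * a / c ^ 2 = q ^ (1 + (i + r)) * a / c ^ 2 * q ^ i := by ring
  have f3 : qPoch a q k * qPoch (a * q ^ k) q r = qPoch a q r * qPoch (a * q ^ r) q k := by
    rw [← qPoch_add, ← qPoch_add, add_comm]
  have f4 : qPoch (q ^ (1 + (i + r)) * a / c ^ 2) q k *
      qPoch (q ^ (1 + (i + r)) * a / c ^ 2 * q ^ k) q i =
      qPoch (q ^ (1 + (i + r)) * a / c ^ 2) q i *
        qPoch (q ^ (1 + (i + r)) * a / c ^ 2 * q ^ i) q k := by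
    rw [← qPoch_add, ← qPoch_add, add_comm k i]
  have r1 := qPoch_reflect_tail (x := q) (y := q ^ (-((i + r : ℕ) : ℤ))) i r hq (by
    rw [zpow_neg, zpow_natCast, mul_assoc, inv_mul_cancel₀ (pow_ne_zero _ hq), mul_one])
  have r2 := qPoch_reflect_tail (x := a) (y := q ^ (1 - ((i + r : ℕ) : ℤ)) / a) i r hq (by
    rw [zpow_sub₀ hq, zpow_natCast, zpow_one]; field_simp)
  have r34 : qPoch (-q ^ (-((i + r : ℕ) : ℤ)) * c) q (i + r) /
      qPoch (q ^ (-((i + r : ℕ) : ℤ) - 1) * c ^ 2) q (i + r) =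
      (-q / c) ^ (i + r) * qPoch (-q / c) q (i + r) / qPoch (q / c ^ 2 * q) q (i + r) := by
    have h : (-(-q ^ (-((i + r : ℕ) : ℤ)) * c)) ^ (i + r) =
        (-q / c) ^ (i + r) * (-(q ^ (-((i + r : ℕ) : ℤ) - 1) * c ^ 2)) ^ (i + r) := by
      rw [← mul_pow, zpow_sub_one₀ hq]; congr 1; field_simp
    have hC : q ^ ((i + r).choose 2) ≠ 0 := pow_ne_zero _ hq
    have hX : (-(q ^ (-((i + r : ℕ) : ℤ) - 1) * c ^ 2)) ^ (i + r) ≠ 0 :=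
      pow_ne_zero _ (neg_ne_zero.2 (mul_ne_zero (zpow_ne_zero _ hq) (pow_ne_zero _ hc)))
    rw [r3, r4, h]
    generalize (-(q ^ (-((i + r : ℕ) : ℤ) - 1) * c ^ 2)) ^ (i + r) = X1 at *
    generalize qPoch (q / c ^ 2 * q) q (i + r) = X2 at *
    field_simp
  have hco : outerCoeff q a c (i + r) i = qPoch a q (i + r) / qPoch (-q * a / c) q (i + r) *
      (qPoch (-q ^ (-((i + r : ℕ) : ℤ)) * c) q (i + r) /
      qPoch (q ^ (-((i + r : ℕ) : ℤ) - 1) * c ^ 2) q (i + r)) *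
      ((-1) ^ i * (c / a) ^ i * ((1 - q / c ^ 2 * q ^ (2 * i)) / (1 - q / c ^ 2)) *
    (qPoch (q ^ (-((i + r : ℕ) : ℤ))) q i * qPoch (q ^ (1 + (i + r)) * a / c ^ 2) q i *
      qPoch (q / c ^ 2) q i / (qPoch q q i * qPoch (q ^ (1 - ((i + r : ℕ) : ℤ)) / a) q i *
      qPoch (q ^ (2 + (i + r)) / c ^ 2) q i))) := by
    have : q ^ (1 + 2 * i) / c ^ 2 = q / c ^ 2 * q ^ (2 * i) := by ring
    rw [outerCoeff, this]
    ring
  rw [hco, r34, f1, f2, Nat.add_sub_cancel_left, hαi i]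
  have m1 := qPoch_ne_zero_of_le hi1 (show i ≤ i + r by omega)
  have m2 := qPoch_ne_zero_of_le hi1 (show r ≤ i + r by omega)
  have m3 := qPoch_ne_zero_of_le hi2 (show i ≤ i + r by omega)
  have m4 := qPoch_ne_zero_of_le hi3 (show i ≤ i + r by omega)
  have hqr : q ^ (r * i) ≠ 0 := pow_ne_zero _ hq
  have hqi : q ^ (i.choose 2) ≠ 0 := pow_ne_zero _ hq
  have s1 : (-a) ^ i = (-1) ^ i * a ^ i := neg_pow _ _
  have s2 : (-q) ^ i = (-1) ^ i * q ^ i := neg_pow _ _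
  have s3 : (-q / c) ^ (i + r) = (-1) ^ i * q ^ i / c ^ i * (-q / c) ^ r := by
    rw [pow_add, div_pow, s2]
  have s4 : ((-1 : ℂ) ^ i) ^ 2 = 1 := by rw [← pow_mul, mul_comm, pow_mul]; simp
  rw [r1, r2, s1, s2, s3, div_pow c a]
  clear lhs key r1 r2 r3 r4 r34 hco hαi hα e1 e2 e3 e4 e5 e6 s1 s2 s3 f1 f2 hD hD' hDD hp1 hi1
    hi2 hi3 hdl
  generalize qPoch (q / c ^ 2 * q) q (i + r) = X1 at *
  generalize qPoch (q ^ (2 + (i + r)) / c ^ 2) q i = X2 at *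
  generalize qPoch (q ^ (1 - ((i + r : ℕ) : ℤ)) / a) q i = X3 at *
  generalize qPoch (q ^ (-((i + r : ℕ) : ℤ))) q i = X4 at *
  generalize qPoch (q / c ^ 2) q i = X5 at *
  generalize qPoch (-q * a / c) q (i + r) = X6 at *
  generalize qPoch (-q * a / c * q ^ (i + r)) q k = X7 at *
  generalize 1 - q / c ^ 2 * q ^ (2 * i) = X8 at *
  generalize 1 - q / c ^ 2 = X9 at *
  generalize qPoch (-q / c) q (i + r) = X10 at *
  generalize (-q / c) ^ r = X11 at *
  generalize qPoch (q ^ (1 + (i + r)) * a / c ^ 2) q k = Y1 at *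
  generalize qPoch (q ^ (1 + (i + r)) * a / c ^ 2 * q ^ k) q i = Y2 at *
  generalize qPoch (q ^ (1 + (i + r)) * a / c ^ 2) q i = Y3 at *
  generalize qPoch (q ^ (1 + (i + r)) * a / c ^ 2 * q ^ i) q k = Y4 at *
  generalize qPoch a q k = Y5 at *
  generalize qPoch (a * q ^ k) q r = Y6 at *
  generalize qPoch a q r = Y7 at *
  generalize qPoch (a * q ^ r) q k = Y8 at *
  generalize (-1 : ℂ) ^ i = s at *
  have hs : s ≠ 0 := by rintro rfl; simp at s4
  field_simp
  rw [s4]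
  linear_combination X4 * X8 * X5 * X10 * X11 * (Y1 * Y2 * f3 + Y7 * Y8 * f4)

/-! ### The transformation away from roots of unity -/

/-- The finite form of the transformation, for `q` not a root of unity. This excludes zeros of
auxiliary denominators such as `(-q ^ (-n); q)_k`, on which the closed formula does not depend. -/
theorem sum_qHypTerm_eq_of_pow_ne_one {q a c : ℂ} {l m n : ℕ} (hmn : m ≤ n)
    (hq : q ≠ 0) (hq1 : ∀ k : ℕ, q ^ (k + 1) ≠ 1) (ha : a ≠ 0) (hc : c ≠ 0)
    (hd1 : qPoch (q ^ (1 + (l : ℤ)) * a / c) q n ≠ 0)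
    (hd2 : qPoch (q ^ (1 - (m : ℤ) + n) * a) q n ≠ 0)
    (hd3 : qPoch (-q ^ (-(n : ℤ)) * c) q n ≠ 0)
    (hp1 : qPoch (q ^ (-(l : ℤ) - 1) * c ^ 2) q l ≠ 0)
    (hp2 : qPoch (-q * a / c) q l ≠ 0)
    (hi0 : 1 - q / c ^ 2 ≠ 0)
    (hi2 : qPoch (q ^ (1 - (l : ℤ)) / a) q l ≠ 0)
    (hi3 : qPoch (q ^ (2 + (l : ℤ)) / c ^ 2) q l ≠ 0)
    (hj5 : qPoch (q ^ (2 + 2 * (l : ℤ)) * a ^ 2 / c ^ 2) (q ^ 2) n ≠ 0) :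
    ∑ k ∈ Finset.range (n + 1), qHypTerm q q
        [a, c, q ^ (-(n : ℤ)), -q ^ (1 + (l : ℤ) - m + n) * a / c]
        [q ^ (1 + (l : ℤ)) * a / c, q ^ (1 - (m : ℤ) + n) * a, -q ^ (-(n : ℤ)) * c] k =
      qFrac q [a, -q ^ (-(l : ℤ)) * c] [q ^ (-(l : ℤ) - 1) * c ^ 2, -q * a / c] l *
      qFrac q [q ^ (1 - (m : ℤ) + n), -q * a / c] [q ^ (1 - (m : ℤ) + n) * a, -q / c] n *
      ∑ i ∈ Finset.range (l + 1), ∑ j ∈ Finset.range (m + 1),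
        (-1) ^ i * q ^ (((m : ℤ) - n) * j + ((j + 1).choose 2 : ℤ)) * (c / a) ^ i *
        ((1 - q ^ (1 + 2 * i) / c ^ 2) / (1 - q / c ^ 2)) *
        qFrac q
          [q ^ (-(l : ℤ)), q ^ (1 + l) * a / c ^ 2, q / c ^ 2]
          [q, q ^ (1 - (l : ℤ)) / a, q ^ (2 + l) / c ^ 2] i *
        qFrac q
          [q ^ (-(m : ℤ)), q ^ (-(n : ℤ)), -q ^ (-(n : ℤ)),
            q ^ ((l : ℤ) - i) * a, q ^ (1 + l + i) * a / c ^ 2]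
          [q, q ^ (1 + (l : ℤ)) * a / c, -q ^ (1 + (l : ℤ)) * a / c,
            q ^ ((m : ℤ) - 2 * n), q ^ ((j : ℤ) - 2 * n - 1)] j *
        qFrac (q ^ 2)
          [q ^ (1 + (l : ℤ) - i + j) * a, q ^ (2 + l + i + j) * a / c ^ 2]
          [q, q ^ (2 + 2 * l + 2 * j) * a ^ 2 / c ^ 2] (n - j) := by
  have hqz (z : ℤ) : q ^ z ≠ 0 := zpow_ne_zero _ hq
  obtain ⟨E, hE⟩ : ∃ E : ℂ, E = q ^ (1 + (l : ℤ)) * a / c := ⟨_, rfl⟩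
  have hEneg : -q ^ (1 + (l : ℤ)) * a / c = -E := by rw [hE]; ring
  have hE2 : E ^ 2 = q ^ (2 + 2 * (l : ℤ)) * a ^ 2 / c ^ 2 := by
    have : q ^ (2 + 2 * (l : ℤ)) = q ^ (1 + (l : ℤ)) * q ^ (1 + (l : ℤ)) := by
      rw [← zpow_add₀ hq]; congr 1; ring
    rw [hE, this]; ring
  rw [← hE2, qPoch_sq] at hj5
  have hEn := left_ne_zero_of_mul hj5
  have hEn' := right_ne_zero_of_mul hj5
  -- the factors of index `l` and beyond are those of `(-E; q)_n`
  have hD : qPoch (-q * a / c) q (l + n) ≠ 0 := by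
    have : -q * a / c * q ^ l = -E := by
      rw [hE, zpow_add₀ hq, zpow_natCast, zpow_one]; ring
    rw [qPoch_add, this]
    exact mul_ne_zero hp2 hEn'
  have hDn := qPoch_ne_zero_of_le hD (show n ≤ l + n by omega)
  have hw : q ^ (-(n : ℤ)) * q ^ n = 1 := by
    rw [zpow_neg, zpow_natCast, inv_mul_cancel₀ (pow_ne_zero _ hq)]
  have e1 : a * (q * q ^ (-(n : ℤ))) / (q ^ (1 - (m : ℤ) + n) * a) = q ^ ((m : ℤ) - 2 * n) := by
    have : q ^ ((m : ℤ) - 2 * n) * q ^ (1 - (m : ℤ) + n) = q * q ^ (-(n : ℤ)) := by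
      rw [← zpow_add₀ hq, ← zpow_one_add₀ hq]; congr 1; ring
    rw [← this]; have := hqz (1 - (m : ℤ) + n); field_simp
  have e2 : a * (q * q ^ (-(n : ℤ))) / (-q ^ (-(n : ℤ)) * c) = -q * a / c := by
    have := hqz (-(n : ℤ)); field_simp
  have e3 : q ^ (1 - (m : ℤ) + n) * a / a = q ^ (1 - (m : ℤ) + n) := by field_simp
  have e4 : q ^ (1 + (l : ℤ)) * a / c / c = q ^ (1 + l) * a / c ^ 2 := by
    rw [← zpow_natCast q (1 + l)]; push_cast; field_simp
  have e5 : q ^ (1 + (l : ℤ)) * a / c / (-q ^ (1 + (l : ℤ) - m + n) * a / c) =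
      -q ^ ((m : ℤ) - n) := by
    have : q ^ (1 + (l : ℤ)) = q ^ ((m : ℤ) - n) * q ^ (1 + (l : ℤ) - m + n) := by
      rw [← zpow_add₀ hq]; congr 1; ring
    rw [this]; have := hqz (1 + (l : ℤ) - m + n); field_simp
  have hbal : q ^ (1 + (l : ℤ)) * a / c * (q ^ (1 - (m : ℤ) + n) * a) * (-q ^ (-(n : ℤ)) * c) =
      a * c * (-q ^ (1 + (l : ℤ) - m + n) * a / c) * (q * q ^ (-(n : ℤ))) := by
    have : q ^ (1 + (l : ℤ)) * q ^ (1 - (m : ℤ) + n) = q ^ (1 + (l : ℤ) - m + n) * q := by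
      rw [← zpow_add₀ hq, ← zpow_add_one₀ hq]; congr 1; ring
    field_simp
    linear_combination -this
  have sears := sears_transformation (q := q) (a := a) (b := c)
    (c := -q ^ (1 + (l : ℤ) - m + n) * a / c) (d := q ^ (1 + (l : ℤ)) * a / c)
    (e := q ^ (1 - (m : ℤ) + n) * a) (f := -q ^ (-(n : ℤ)) * c) (w := q ^ (-(n : ℤ))) n hq ha hc
    (div_ne_zero (mul_ne_zero (neg_ne_zero.2 (hqz _)) ha) hc)
    (div_ne_zero (mul_ne_zero (hqz _) ha) hc) (mul_ne_zero (hqz _) ha)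
    (mul_ne_zero (neg_ne_zero.2 (hqz _)) hc) hw hbal (qPoch_self_ne_zero hq1 n) hd1 hd2 hd3
    (by rw [e1]; exact qPoch_zpow_ne_zero hq hq1 fun i hi => by omega) (by rwa [e2])
  rw [e1, e2, e3, e4, e5] at sears
  -- reversing the factors brings the prefactor of Sears' transformation into the stated form
  have hpre : qPoch (-q ^ (-(n : ℤ)) * c / a) q n * a ^ n / qPoch (-q ^ (-(n : ℤ)) * c) q n =
      qPoch (-q * a / c) q n / qPoch (-q / c) q n := by
    have r1 := qPoch_reflect (q := q) (x := -q ^ (-(n : ℤ)) * c) (y := -q / c) n hq (by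
      field_simp; linear_combination hw)
    have r2 := qPoch_reflect (q := q) (x := -q ^ (-(n : ℤ)) * c / a) (y := -q * a / c) n hq (by
      field_simp; linear_combination hw)
    have h1 : (-(-q ^ (-(n : ℤ)) * c)) ^ n ≠ 0 :=
      pow_ne_zero _ (neg_ne_zero.2 (mul_ne_zero (neg_ne_zero.2 (hqz _)) hc))
    have h2 : q ^ (n.choose 2) ≠ 0 := pow_ne_zero _ hq
    rw [r1, r2, ← neg_div, div_pow]
    generalize (-(-q ^ (-(n : ℤ)) * c)) ^ n = X1 at *
    generalize qPoch (-q / c) q n = X2 at *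
    generalize qPoch (-q * a / c) q n = X3 at *
    field_simp
  have lhs : ∑ k ∈ Finset.range (n + 1), qHypTerm q q
        [a, c, q ^ (-(n : ℤ)), -q ^ (1 + (l : ℤ) - m + n) * a / c]
        [q ^ (1 + (l : ℤ)) * a / c, q ^ (1 - (m : ℤ) + n) * a, -q ^ (-(n : ℤ)) * c] k =
      qPoch (q ^ (1 - (m : ℤ) + n)) q n / qPoch (q ^ (1 - (m : ℤ) + n) * a) q n *
      (qPoch (-q * a / c) q n / qPoch (-q / c) q n) *
      ∑ k ∈ Finset.range (n + 1), qPoch (q ^ (-(n : ℤ))) q k * qPoch (-q ^ ((m : ℤ) - n)) q k /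
        (qPoch q q k * qPoch E q k * qPoch (q ^ ((m : ℤ) - 2 * n)) q k) * q ^ k *
        (qPoch a q k * qPoch (q ^ (1 + l) * a / c ^ 2) q k / qPoch (-q * a / c) q k) := by
    rw [← hpre, hE]
    refine Eq.trans ?_ (sears.trans ?_)
    · refine Finset.sum_congr rfl fun k _ => ?_
      simp only [qHypTerm, qFrac, List.map_cons, List.map_nil, List.prod_cons, List.prod_nil]
      ring
    · congr 1
      · ring
      · refine Finset.sum_congr rfl fun k _ => ?_
        ring
  have hi3' : qPoch (q ^ (2 + l) / c ^ 2) q l ≠ 0 := by exact_mod_cast hi3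
  have hsum : ∑ k ∈ Finset.range (n + 1),
        qPoch (q ^ (-(n : ℤ))) q k * qPoch (-q ^ ((m : ℤ) - n)) q k /
        (qPoch q q k * qPoch E q k * qPoch (q ^ ((m : ℤ) - 2 * n)) q k) * q ^ k *
        (qPoch a q k * qPoch (q ^ (1 + l) * a / c ^ 2) q k / qPoch (-q * a / c) q k) =
      ∑ i ∈ Finset.range (l + 1), outerCoeff q a c l i * ∑ k ∈ Finset.range (n + 1),
        qPoch (q ^ (-(n : ℤ))) q k * qPoch (-q ^ ((m : ℤ) - n)) q k *
        qPoch (q ^ ((l : ℤ) - i) * a) q k * qPoch (q ^ (1 + l + i) * a / c ^ 2) q k /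
        (qPoch q q k * qPoch E q k * qPoch (-E) q k * qPoch (q ^ ((m : ℤ) - 2 * n)) q k) *
        q ^ k := by
    simp_rw [Finset.mul_sum]
    rw [Finset.sum_comm]
    refine Finset.sum_congr rfl fun k hk => ?_
    have hkn : k ≤ n := by have := Finset.mem_range.1 hk; omega
    rw [qPoch_div_expansion_outer k hq ha hc hp1 hi0 (qPoch_self_ne_zero hq1 l) hi2 hi3'
      (qPoch_ne_zero_of_le hD (by omega)), Finset.mul_sum, hEneg]
    refine Finset.sum_congr rfl fun i _ => ?_
    ring
  rw [lhs, hsum, Finset.mul_sum, Finset.mul_sum]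
  refine Finset.sum_congr rfl fun i hi => ?_
  have hil : i ≤ l := by have := Finset.mem_range.1 hi; omega
  have hEAB : E ^ 2 = q * (q ^ ((l : ℤ) - i) * a) * (q ^ (1 + l + i) * a / c ^ 2) := by
    have : q ^ (2 + 2 * (l : ℤ)) = q * q ^ ((l : ℤ) - i) * q ^ (1 + l + i) := by
      rw [← zpow_natCast q (1 + l + i), ← zpow_one_add₀ hq, ← zpow_add₀ hq]
      congr 1; push_cast; ring
    rw [hE2, this]; ring
  rw [qWatson_sum_extended hq hq1 hmn hEAB hEn hEn', Finset.mul_sum, Finset.mul_sum,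
    Finset.mul_sum]
  refine Finset.sum_congr rfl fun j _ => ?_
  have g1 : q * (q ^ ((l : ℤ) - i) * a * q ^ j) = q ^ (1 + (l : ℤ) - i + j) * a := by
    have : q ^ (1 + (l : ℤ) - i + j) = q * q ^ ((l : ℤ) - i) * q ^ j := by
      rw [← zpow_natCast q j, ← zpow_one_add₀ hq, ← zpow_add₀ hq]; congr 1; ring
    rw [this]; ring
  have g2 : q * (q ^ (1 + l + i) * a / c ^ 2 * q ^ j) = q ^ (2 + l + i + j) * a / c ^ 2 := by ring
  have g3 : (E * q ^ j) ^ 2 = q ^ (2 + 2 * l + 2 * j) * a ^ 2 / c ^ 2 := by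
    have : q ^ (1 + (l : ℤ)) = q ^ (1 + l) := by exact_mod_cast zpow_natCast q (1 + l)
    rw [hE, this]; ring
  rw [g1, g2, g3, ← hE, hEneg]
  simp only [outerCoeff, qFrac, List.map_cons, List.map_nil, List.prod_cons, List.prod_nil]
  ring

/-! ### Continuity in `q` -/

theorem continuousAt_qPoch {x g : ℂ → ℂ} {q : ℂ} (hx : ContinuousAt x q) (hg : ContinuousAt g q)
    (n : ℕ) : ContinuousAt (fun t => qPoch (x t) (g t) n) q := by
  unfold qPoch
  fun_prop

theorem continuousAt_prod_map_qPoch {g : ℂ → ℂ} {q : ℂ} (hg : ContinuousAt g q) (n : ℕ)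
    (L : List (ℂ → ℂ)) (hL : ∀ x ∈ L, ContinuousAt x q) :
    ContinuousAt (fun t => (L.map fun x => qPoch (x t) (g t) n).prod) q := by
  induction L with
  | nil => simpa using continuousAt_const
  | cons x L ih =>
    simp only [List.map_cons, List.prod_cons]
    exact (continuousAt_qPoch (hL x (by simp)) hg n).mul (ih fun y hy => hL y (by simp [hy]))

/-- Continuity of `qFrac` in the entries and the base, where no denominator vanishes. -/
theorem continuousAt_qFrac {g : ℂ → ℂ} {q : ℂ} (hg : ContinuousAt g q) (n : ℕ)
    (N D : List (ℂ → ℂ)) (hN : ∀ x ∈ N, ContinuousAt x q) (hD : ∀ x ∈ D, ContinuousAt x q)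
    (h0 : ∀ x ∈ D, qPoch (x q) (g q) n ≠ 0) :
    ContinuousAt (fun t => qFrac (g t) (N.map fun x => x t) (D.map fun x => x t) n) q := by
  unfold qFrac
  simp only [List.map_map, Function.comp_def]
  refine (continuousAt_prod_map_qPoch hg n N hN).div (continuousAt_prod_map_qPoch hg n D hD) ?_
  refine List.prod_ne_zero fun h => ?_
  obtain ⟨x, hx, hx0⟩ := List.mem_map.1 h
  exact h0 x hx hx0

/-- Roots of unity are countable, so every `q` is a limit of numbers that are not roots of unity. -/
theorem frequently_pow_ne_one (q : ℂ) : ∃ᶠ t in nhds q, ∀ k : ℕ, t ^ (k + 1) ≠ 1 := by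
  have hcount : Set.Countable {t : ℂ | ∃ k : ℕ, t ^ (k + 1) = 1} := by
    rw [Set.ofPred_exists]
    refine Set.countable_iUnion fun k => Set.Finite.countable ?_
    refine (Polynomial.nthRoots (k + 1) (1 : ℂ)).toFinset.finite_toSet.subset fun t ht => ?_
    simpa [Polynomial.mem_nthRoots (Nat.succ_pos k)] using ht
  have := (hcount.dense_compl ℂ).closure_eq
  have hq : q ∈ closure {t : ℂ | ∃ k : ℕ, t ^ (k + 1) = 1}ᶜ := by rw [this]; trivial
  refine (mem_closure_iff_frequently.1 hq).mono fun t ht k hk => ht ⟨k, hk⟩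

set_option maxHeartbeats 800000 in
/-- The summands of the double sum are continuous in `q` where their denominators do not vanish. -/
theorem continuousAt_summand {q a c : ℂ} {l m n i j : ℕ} (hmn : m ≤ n) (hq : q ≠ 0)
    (hqn : qPoch q q n ≠ 0)
    (hd1 : qPoch (q ^ (1 + (l : ℤ)) * a / c) q n ≠ 0)
    (hi0 : 1 - q / c ^ 2 ≠ 0)
    (hi1 : qPoch q q l ≠ 0)
    (hi2 : qPoch (q ^ (1 - (l : ℤ)) / a) q l ≠ 0)
    (hi3 : qPoch (q ^ (2 + (l : ℤ)) / c ^ 2) q l ≠ 0)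
    (hj1 : qPoch (-q ^ (1 + (l : ℤ)) * a / c) q m ≠ 0)
    (hj2 : qPoch (q ^ ((m : ℤ) - 2 * n)) q m ≠ 0)
    (hj3 : ∀ j ≤ m, qPoch (q ^ ((j : ℤ) - 2 * n - 1)) q j ≠ 0)
    (hj4 : qPoch q (q ^ 2) n ≠ 0)
    (hj5 : qPoch (q ^ (2 + 2 * (l : ℤ)) * a ^ 2 / c ^ 2) (q ^ 2) n ≠ 0)
    (hil : i ≤ l) (hjm : j ≤ m) :
    ContinuousAt (fun t : ℂ =>
        (-1) ^ i * t ^ (((m : ℤ) - n) * j + ((j + 1).choose 2 : ℤ)) * (c / a) ^ i *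
        ((1 - t ^ (1 + 2 * i) / c ^ 2) / (1 - t / c ^ 2)) *
        qFrac t
          [t ^ (-(l : ℤ)), t ^ (1 + l) * a / c ^ 2, t / c ^ 2]
          [t, t ^ (1 - (l : ℤ)) / a, t ^ (2 + l) / c ^ 2] i *
        qFrac t
          [t ^ (-(m : ℤ)), t ^ (-(n : ℤ)), -t ^ (-(n : ℤ)),
            t ^ ((l : ℤ) - i) * a, t ^ (1 + l + i) * a / c ^ 2]
          [t, t ^ (1 + (l : ℤ)) * a / c, -t ^ (1 + (l : ℤ)) * a / c,
            t ^ ((m : ℤ) - 2 * n), t ^ ((j : ℤ) - 2 * n - 1)] j *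
        qFrac (t ^ 2)
          [t ^ (1 + (l : ℤ) - i + j) * a, t ^ (2 + l + i + j) * a / c ^ 2]
          [t, t ^ (2 + 2 * l + 2 * j) * a ^ 2 / c ^ 2] (n - j)) q := by
  have hid : ContinuousAt (fun t : ℂ => t) q := continuousAt_id
  refine ContinuousAt.mul (ContinuousAt.mul (ContinuousAt.mul (ContinuousAt.mul ?_
      (ContinuousAt.div ?_ ?_ hi0))
    (continuousAt_qFrac hid i
      [fun t => t ^ (-(l : ℤ)), fun t => t ^ (1 + l) * a / c ^ 2, fun t => t / c ^ 2]
      [fun t => t, fun t => t ^ (1 - (l : ℤ)) / a, fun t => t ^ (2 + l) / c ^ 2] ?_ ?_ ?_))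
    (continuousAt_qFrac hid j
      [fun t => t ^ (-(m : ℤ)), fun t => t ^ (-(n : ℤ)), fun t => -t ^ (-(n : ℤ)),
        fun t => t ^ ((l : ℤ) - i) * a, fun t => t ^ (1 + l + i) * a / c ^ 2]
      [fun t => t, fun t => t ^ (1 + (l : ℤ)) * a / c, fun t => -t ^ (1 + (l : ℤ)) * a / c,
        fun t => t ^ ((m : ℤ) - 2 * n), fun t => t ^ ((j : ℤ) - 2 * n - 1)] ?_ ?_ ?_))
    (continuousAt_qFrac (hid.pow 2) (n - j)
      [fun t => t ^ (1 + (l : ℤ) - i + j) * a, fun t => t ^ (2 + l + i + j) * a / c ^ 2]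
      [fun t => t, fun t => t ^ (2 + 2 * l + 2 * j) * a ^ 2 / c ^ 2] ?_ ?_ ?_)
  · fun_prop (disch := exact Or.inl hq)
  · fun_prop
  · fun_prop
  · simp only [List.forall_mem_cons]
    refine ⟨?_, ?_, ?_, by simp⟩ <;> fun_prop (disch := exact Or.inl hq)
  · simp only [List.forall_mem_cons]
    refine ⟨?_, ?_, ?_, by simp⟩ <;> fun_prop (disch := exact Or.inl hq)
  · simp only [List.forall_mem_cons]
    exact ⟨qPoch_ne_zero_of_le hi1 hil, qPoch_ne_zero_of_le hi2 hil,
      qPoch_ne_zero_of_le (by exact_mod_cast hi3) hil, by simp⟩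
  · simp only [List.forall_mem_cons]
    refine ⟨?_, ?_, ?_, ?_, ?_, by simp⟩ <;> fun_prop (disch := exact Or.inl hq)
  · simp only [List.forall_mem_cons]
    refine ⟨?_, ?_, ?_, ?_, ?_, by simp⟩ <;> fun_prop (disch := exact Or.inl hq)
  · simp only [List.forall_mem_cons]
    exact ⟨qPoch_ne_zero_of_le hqn (hjm.trans hmn), qPoch_ne_zero_of_le hd1 (hjm.trans hmn),
      qPoch_ne_zero_of_le hj1 hjm, qPoch_ne_zero_of_le hj2 hjm, hj3 j hjm, by simp⟩
  · simp only [List.forall_mem_cons]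
    refine ⟨?_, ?_, by simp⟩ <;> fun_prop (disch := exact Or.inl hq)
  · simp only [List.forall_mem_cons]
    refine ⟨?_, ?_, by simp⟩ <;> fun_prop (disch := exact Or.inl hq)
  · simp only [List.forall_mem_cons]
    refine ⟨qPoch_ne_zero_of_le hj4 (by omega), ?_, by simp⟩
    have hs := qPoch_shift_ne_zero hj5 (show j + (n - j) ≤ n by omega)
    have : q ^ (2 + 2 * (l : ℤ)) * a ^ 2 / c ^ 2 * (q ^ 2) ^ j =
        q ^ (2 + 2 * l + 2 * j) * a ^ 2 / c ^ 2 := by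
      have : q ^ (2 + 2 * (l : ℤ)) = q ^ (2 + 2 * l) := by
        exact_mod_cast zpow_natCast q (2 + 2 * l)
      rw [this]; ring
    rwa [this] at hs

theorem theorem8 (q a c : ℂ) (l m n : ℕ) (hmn : m ≤ n)
    (hq : q ≠ 0) (ha : a ≠ 0) (hc : c ≠ 0)
    -- no zero factor in the denominators of the series (`0 ≤ k ≤ n`)
    (hqn : qPoch q q n ≠ 0)
    (hd1 : qPoch (q ^ (1 + (l : ℤ)) * a / c) q n ≠ 0)
    (hd2 : qPoch (q ^ (1 - (m : ℤ) + n) * a) q n ≠ 0)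
    (hd3 : qPoch (-q ^ (-(n : ℤ)) * c) q n ≠ 0)
    -- no zero factor in the denominators of the prefactor
    (hp1 : qPoch (q ^ (-(l : ℤ) - 1) * c ^ 2) q l ≠ 0)
    (hp2 : qPoch (-q * a / c) q l ≠ 0)
    (hp3 : qPoch (-q / c) q n ≠ 0)
    -- no zero factor in the denominators that depend on `i`
    (hi0 : 1 - q / c ^ 2 ≠ 0)
    (hi1 : qPoch q q l ≠ 0)
    (hi2 : qPoch (q ^ (1 - (l : ℤ)) / a) q l ≠ 0)
    (hi3 : qPoch (q ^ (2 + (l : ℤ)) / c ^ 2) q l ≠ 0)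
    -- no zero factor in the denominators that depend on `j`
    (hj1 : qPoch (-q ^ (1 + (l : ℤ)) * a / c) q m ≠ 0)
    (hj2 : qPoch (q ^ ((m : ℤ) - 2 * n)) q m ≠ 0)
    (hj3 : ∀ j ≤ m, qPoch (q ^ ((j : ℤ) - 2 * n - 1)) q j ≠ 0)
    (hj4 : qPoch q (q ^ 2) n ≠ 0)
    (hj5 : qPoch (q ^ (2 + 2 * (l : ℤ)) * a ^ 2 / c ^ 2) (q ^ 2) n ≠ 0) :
    Summable (qHypTerm q q
        [a, c, q ^ (-(n : ℤ)), -q ^ (1 + (l : ℤ) - m + n) * a / c]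
        [q ^ (1 + (l : ℤ)) * a / c, q ^ (1 - (m : ℤ) + n) * a, -q ^ (-(n : ℤ)) * c]) ∧
    qHyp q q
        [a, c, q ^ (-(n : ℤ)), -q ^ (1 + (l : ℤ) - m + n) * a / c]
        [q ^ (1 + (l : ℤ)) * a / c, q ^ (1 - (m : ℤ) + n) * a, -q ^ (-(n : ℤ)) * c] =
      qFrac q [a, -q ^ (-(l : ℤ)) * c] [q ^ (-(l : ℤ) - 1) * c ^ 2, -q * a / c] l *
      qFrac q [q ^ (1 - (m : ℤ) + n), -q * a / c] [q ^ (1 - (m : ℤ) + n) * a, -q / c] n *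
      ∑ i ∈ Finset.range (l + 1), ∑ j ∈ Finset.range (m + 1),
        (-1) ^ i * q ^ (((m : ℤ) - n) * j + ((j + 1).choose 2 : ℤ)) * (c / a) ^ i *
        ((1 - q ^ (1 + 2 * i) / c ^ 2) / (1 - q / c ^ 2)) *
        qFrac q
          [q ^ (-(l : ℤ)), q ^ (1 + l) * a / c ^ 2, q / c ^ 2]
          [q, q ^ (1 - (l : ℤ)) / a, q ^ (2 + l) / c ^ 2] i *
        qFrac q
          [q ^ (-(m : ℤ)), q ^ (-(n : ℤ)), -q ^ (-(n : ℤ)),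
            q ^ ((l : ℤ) - i) * a, q ^ (1 + l + i) * a / c ^ 2]
          [q, q ^ (1 + (l : ℤ)) * a / c, -q ^ (1 + (l : ℤ)) * a / c,
            q ^ ((m : ℤ) - 2 * n), q ^ ((j : ℤ) - 2 * n - 1)] j *
        qFrac (q ^ 2)
          [q ^ (1 + (l : ℤ) - i + j) * a, q ^ (2 + l + i + j) * a / c ^ 2]
          [q, q ^ (2 + 2 * l + 2 * j) * a ^ 2 / c ^ 2] (n - j) := by
  -- `(q ^ (-n); q)_k` vanishes for `k > n`; beyond `n` a lower factorial may vanish as well, and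
  -- the term is still `0`
  have hzero : ∀ k ∉ Finset.range (n + 1), qHypTerm q q
      [a, c, q ^ (-(n : ℤ)), -q ^ (1 + (l : ℤ) - m + n) * a / c]
      [q ^ (1 + (l : ℤ)) * a / c, q ^ (1 - (m : ℤ) + n) * a, -q ^ (-(n : ℤ)) * c] k = 0 := by
    intro k hk
    have hnk : n < k := by have := mt Finset.mem_range.2 hk; omega
    have : qPoch (q ^ (-(n : ℤ))) q k = 0 := by
      by_contra h
      refine qPoch_ne_zero_iff.1 h n hnk ?_
      rw [zpow_neg, zpow_natCast, inv_mul_cancel₀ (pow_ne_zero _ hq)]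
    simp only [qHypTerm, qFrac, List.map_cons, List.prod_cons, this, zero_mul, mul_zero, zero_div]
  refine ⟨summable_of_ne_finset_zero hzero, ?_⟩
  rw [qHyp, tsum_eq_sum hzero]
  have hid : ContinuousAt (fun t : ℂ => t) q := continuousAt_id
  have hz (z : ℤ) : ContinuousAt (fun t : ℂ => t ^ z) q := continuousAt_zpow₀ q z (Or.inl hq)
  have hev {x g : ℂ → ℂ} {k : ℕ} (hx : ContinuousAt x q) (hg : ContinuousAt g q)
      (h : qPoch (x q) (g q) k ≠ 0) : ∀ᶠ t in nhds q, qPoch (x t) (g t) k ≠ 0 :=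
    (continuousAt_qPoch hx hg k).eventually_ne h
  -- the identity holds at numbers near `q` that are not roots of unity, and both sides are
  -- continuous at `q`
  refine tendsto_nhds_unique_of_frequently_eq (l := nhds q) (f := fun t =>
      ∑ k ∈ Finset.range (n + 1), qHypTerm t t
        [a, c, t ^ (-(n : ℤ)), -t ^ (1 + (l : ℤ) - m + n) * a / c]
        [t ^ (1 + (l : ℤ)) * a / c, t ^ (1 - (m : ℤ) + n) * a, -t ^ (-(n : ℤ)) * c] k)
    (g := fun t =>
      qFrac t [a, -t ^ (-(l : ℤ)) * c] [t ^ (-(l : ℤ) - 1) * c ^ 2, -t * a / c] l *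
      qFrac t [t ^ (1 - (m : ℤ) + n), -t * a / c] [t ^ (1 - (m : ℤ) + n) * a, -t / c] n *
      ∑ i ∈ Finset.range (l + 1), ∑ j ∈ Finset.range (m + 1),
        (-1) ^ i * t ^ (((m : ℤ) - n) * j + ((j + 1).choose 2 : ℤ)) * (c / a) ^ i *
        ((1 - t ^ (1 + 2 * i) / c ^ 2) / (1 - t / c ^ 2)) *
        qFrac t
          [t ^ (-(l : ℤ)), t ^ (1 + l) * a / c ^ 2, t / c ^ 2]
          [t, t ^ (1 - (l : ℤ)) / a, t ^ (2 + l) / c ^ 2] i *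
        qFrac t
          [t ^ (-(m : ℤ)), t ^ (-(n : ℤ)), -t ^ (-(n : ℤ)),
            t ^ ((l : ℤ) - i) * a, t ^ (1 + l + i) * a / c ^ 2]
          [t, t ^ (1 + (l : ℤ)) * a / c, -t ^ (1 + (l : ℤ)) * a / c,
            t ^ ((m : ℤ) - 2 * n), t ^ ((j : ℤ) - 2 * n - 1)] j *
        qFrac (t ^ 2)
          [t ^ (1 + (l : ℤ) - i + j) * a, t ^ (2 + l + i + j) * a / c ^ 2]
          [t, t ^ (2 + 2 * l + 2 * j) * a ^ 2 / c ^ 2] (n - j)) ?_ ?_ ?_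
  · refine tendsto_finsetSum _ fun k hk => ?_
    have hkn : k ≤ n := by have := Finset.mem_range.1 hk; omega
    refine ContinuousAt.mul (continuousAt_qFrac hid k
      [fun _ => a, fun _ => c, fun t => t ^ (-(n : ℤ)),
        fun t => -t ^ (1 + (l : ℤ) - m + n) * a / c]
      [fun t => t, fun t => t ^ (1 + (l : ℤ)) * a / c, fun t => t ^ (1 - (m : ℤ) + n) * a,
        fun t => -t ^ (-(n : ℤ)) * c] ?_ ?_ ?_) (hid.pow k)
    · simp only [List.forall_mem_cons]
      refine ⟨?_, ?_, ?_, ?_, by simp⟩ <;> fun_prop (disch := exact Or.inl hq)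
    · simp only [List.forall_mem_cons]
      refine ⟨?_, ?_, ?_, ?_, by simp⟩ <;> fun_prop (disch := exact Or.inl hq)
    · simp only [List.forall_mem_cons]
      exact ⟨qPoch_ne_zero_of_le hqn hkn, qPoch_ne_zero_of_le hd1 hkn,
        qPoch_ne_zero_of_le hd2 hkn, qPoch_ne_zero_of_le hd3 hkn, by simp⟩
  · refine ContinuousAt.mul (ContinuousAt.mul
      (continuousAt_qFrac hid l [fun _ => a, fun t => -t ^ (-(l : ℤ)) * c]
        [fun t => t ^ (-(l : ℤ) - 1) * c ^ 2, fun t => -t * a / c] ?_ ?_ ?_)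
      (continuousAt_qFrac hid n [fun t => t ^ (1 - (m : ℤ) + n), fun t => -t * a / c]
        [fun t => t ^ (1 - (m : ℤ) + n) * a, fun t => -t / c] ?_ ?_ ?_))
      (tendsto_finsetSum _ fun i hi => tendsto_finsetSum _ fun j hj => ?_)
    · simp only [List.forall_mem_cons]
      refine ⟨?_, ?_, by simp⟩ <;> fun_prop (disch := exact Or.inl hq)
    · simp only [List.forall_mem_cons]
      refine ⟨?_, ?_, by simp⟩ <;> fun_prop (disch := exact Or.inl hq)
    · simp only [List.forall_mem_cons]
      exact ⟨hp1, hp2, by simp⟩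
    · simp only [List.forall_mem_cons]
      refine ⟨?_, ?_, by simp⟩ <;> fun_prop (disch := exact Or.inl hq)
    · simp only [List.forall_mem_cons]
      refine ⟨?_, ?_, by simp⟩ <;> fun_prop (disch := exact Or.inl hq)
    · simp only [List.forall_mem_cons]
      exact ⟨hd2, hp3, by simp⟩
    exact continuousAt_summand hmn hq hqn hd1 hi0 hi1 hi2 hi3 hj1 hj2 hj3 hj4 hj5
      (by have := Finset.mem_range.1 hi; omega) (by have := Finset.mem_range.1 hj; omega)
  · have h1 := hev (k := n) (((hz (1 + (l : ℤ))).mul_const a).div_const c) hid hd1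
    have h2 := hev (k := n) ((hz (1 - (m : ℤ) + n)).mul_const a) hid hd2
    have h3 := hev (k := n) ((hz (-(n : ℤ))).neg.mul_const c) hid hd3
    have h4 := hev (k := l) ((hz (-(l : ℤ) - 1)).mul_const (c ^ 2)) hid hp1
    have h5 := hev (k := l) ((hid.neg.mul_const a).div_const c) hid hp2
    have h6 := ((hid.div_const (c ^ 2)).const_sub 1).eventually_ne hi0
    have h7 := hev (k := l) ((hz (1 - (l : ℤ))).div_const a) hid hi2
    have h8 := hev (k := l) ((hz (2 + (l : ℤ))).div_const (c ^ 2)) hid hi3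
    have h9 := hev (k := n) (((hz (2 + 2 * (l : ℤ))).mul_const (a ^ 2)).div_const (c ^ 2))
      (hid.pow 2) hj5
    refine ((frequently_pow_ne_one q).and_eventually ((hid.eventually_ne hq).and
      (h1.and (h2.and (h3.and (h4.and (h5.and (h6.and (h7.and (h8.and h9)))))))))).mono ?_
    rintro t ⟨t1, t0, h1, h2, h3, h4, h5, h6, h7, h8, h9⟩
    exact sum_qHypTerm_eq_of_pow_ne_one hmn t0 t1 ha hc h1 h2 h3 h4 h5 h6 h7 h8 h9
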